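/- Let $\tfrac12\le\eta\le1$ and let $\mathcal A(\rho)=K_0\rho K_0^\dagger+K_1\rho K_1^\dagger$ be the qubit amplitude damping channel with transmissivity $\eta$, where $K_0=|1\rangle\langle1|+\sqrt{\eta}\,|0\rangle\langle0|$ and $K_1=\sqrt{1-\eta}\,|1\rangle\langle0|$. For an ensemble $\{p_X(x),|\phi^x\rangle_{AA'}\}_x$ (finite alphabet, finite-dimensional reference system $A$, qubit input $A'$, unit vectors $|\phi^x\rangle$) put $$\rho_{XAB}=\sum_x p_X(x)\,|x\rangle\langle x|_X\otimes(\mathrm{id}_A\otimes\mathcal A_{A'\to B})\big(|\phi^x\rangle\langle\phi^x|_{AA'}\big),$$ and, with $H$ the von Neumann entropy in bits of the indicated reduced states of $\rho_{XAB}$, let $I(AX;B)=H(AX)+H(B)-H(ABX)$, $I(A\rangle BX)=H(BX)-H(ABX)$ and $I(X;B)=H(X)+H(B)-H(BX)$. The single-letter triple trade-off region of $\mathcal A$ is the union, over all such ensembles, of the polyhedra of $(C,Q,E)\in\mathbb R^3$ with $$C+2Q\le I(AX;B),\qquad Q+E\le I(A\rangle BX),\qquad C+Q+E\le I(X;B)+I(A\rangle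 BX).$$ Let $h_2(y)=-y\log_2y-(1-y)\log_2(1-y)$ and $$g(q,z,\nu)=h_2\!\left(\frac{1+\sqrt{(1-2zq)^2+4z\nu^2q(1-q)}}{2}\right).$$ Then the single-letter triple trade-off region of $\mathcal A$ equals the union over all $p,\nu\in[0,1]$ of the polyhedra of $(C,Q,E)\in\mathbb R^3$ with $$C+2Q\le h_2(\eta p)+g(p,1,\nu)-g(p,1-\eta,\nu),$$ $$Q+E\le g(p,\eta,\nu)-g(p,1-\eta,\nu),$$ $$C+Q+E\le h_2(\eta p)-g(p,1-\eta,\nu).$$ Moreover, it is achieved by the ensembles $$\tfrac12|0\rangle\langle0|_X\otimes\begin{pmatrix}1-p&\nu\sqrt{p(1-p)}\\ \nu\sqrt{p(1-p)}&p\end{pmatrix}_{A'}+\tfrac12|1\rangle\langle1|_X\otimes\begin{pmatrix}1-p&-\nu\sqrt{p(1-p)}\\ -\nu\sqrt{p(1-p)}&p\end{pmatrix}_{A'},\qquad p,\nu\in[0,1]$$ (matrices in the ordered basis $(|1\rangle,|0\rangle)$): for all $p,\nu\in[0,1]$ the two states have purifications with a common finite-dimensional reference system, for every such choice of purifications $|\phi^0\rangle,|\phi^1\rangle$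 the quantities $I(AX;B)$, $I(A\rangle BX)$ and $I(X;B)+I(A\rangle BX)$ equal the three right-hand sides above, respectively, and the region is the union over $p,\nu\in[0,1]$ of the polyhedra of these ensembles. -/

import Mathlib

/-!
Since every input is pure, the rates reduce to the entropy of the mean output and to mean output
entropies of damping channels on the input states: the complement of the channel with transmissivity
`η` is, up to relabeling, the one with transmissivity `1 - η`, and the reference has the entropy of
the input, which is the case of transmissivity `1`.
The output entropy of a qubit state `ρ` depends only on the population `P` of `|0⟩` and on
`y = 4 det ρ`, on which damping acts by `(P, y) ↦ (s P, s y + 4 s (1 - s) P²)`.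

The key fact is that the output entropy is a jointly convex function of the population and the
*input entropy*. Given an ensemble, choose the symmetric ensemble with the same mean population and
the same mean entropy after damping by `1 - η`. As damping by `1 - η` factors through damping by
every `z ≥ 1 - η`, Jensen's inequality shows that the symmetric ensemble has the larger mean entropy
for these `z`, in particular for `z = η` and `z = 1`. The entropy of the mean output, on the other
hand, is largest for a diagonal mean, and the two symmetric states average to a diagonal one.

Convexity comes down to a growth bound on `-f' / f''`, where `f` is the entropy as a function of
`4 det ρ`; in the variable `artanh √(1 - y)` it follows from the monotone form of l'Hôpital's rule.
-/

open scoped Matrix Kronecker ComplexConjugate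

noncomputable section

/-- Binary Shannon entropy in bits: `h₂(y) = -y log₂ y - (1-y) log₂ (1-y)`. -/
def h2 (y : ℝ) : ℝ := -y * Real.logb 2 y - (1 - y) * Real.logb 2 (1 - y)

/-- `g(q,z,ν) = h₂((1 + √((1-2zq)² + 4zν²q(1-q)))/2)`. -/
def gFun (q z ν : ℝ) : ℝ :=
  h2 ((1 + Real.sqrt ((1 - 2 * z * q) ^ 2 + 4 * z * ν ^ 2 * q * (1 - q))) / 2)

open Classical in
/-- Von Neumann entropy in bits, `H(ρ) = -Tr(ρ log₂ ρ) = -∑ᵢ λᵢ log₂ λᵢ`, with `λᵢ` the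
eigenvalues of the Hermitian matrix `ρ` (and `0` if `ρ` is not Hermitian, which never
happens for the density matrices below). -/
def vonNeumannEntropy {ι : Type} [Fintype ι] (ρ : Matrix ι ι ℂ) : ℝ :=
  if h : ρ.IsHermitian then
    -∑ i, h.eigenvalues i * Real.logb 2 (h.eigenvalues i)
  else 0

/-- The linear map `ρ ↦ ∑ⱼ Kⱼ ρ Kⱼ†` given by a finite family of Kraus operators. -/
def krausMap {κ α β : Type} [Fintype κ] [Fintype α]
    (K : κ → Matrix β α ℂ) : Matrix α α ℂ →ₗ[ℂ] Matrix β β ℂ where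
  toFun ρ := ∑ j, K j * ρ * (K j)ᴴ
  map_add' ρ σ := by simp [Matrix.mul_add, Matrix.add_mul, Finset.sum_add_distrib]
  map_smul' c ρ := by simp [Finset.smul_sum]

/-- Kraus operators of the qubit amplitude damping channel with transmissivity `η`:
`K₀ = |1⟩⟨1| + √η |0⟩⟨0|` and `K₁ = √(1-η) |1⟩⟨0|`.
The matrix index `k : Fin 2` stands for the basis ket `|k⟩`. -/
def amplitudeDampingKraus (η : ℝ) : Fin 2 → Matrix (Fin 2) (Fin 2) ℂ :=
  ![Matrix.single 1 1 1 + Matrix.single 0 0 ((Real.sqrt η : ℝ) : ℂ),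
    Matrix.single 1 0 ((Real.sqrt (1 - η) : ℝ) : ℂ)]

/-- The qubit amplitude damping channel with transmissivity `η`. -/
def amplitudeDamping (η : ℝ) : Matrix (Fin 2) (Fin 2) ℂ →ₗ[ℂ] Matrix (Fin 2) (Fin 2) ℂ :=
  krausMap (amplitudeDampingKraus η)

/-- `id_A ⊗ N`, acting on operators on `A ⊗ A'`: apply `N` to every `A'`-block. -/
def idTensor {A α β : Type} (N : Matrix α α ℂ →ₗ[ℂ] Matrix β β ℂ)
    (σ : Matrix (A × α) (A × α) ℂ) : Matrix (A × β) (A × β) ℂ :=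
  Matrix.of fun s t => N (Matrix.of fun i j => σ (s.1, i) (t.1, j)) s.2 t.2

/-- An ensemble `{p_X(x), |φˣ⟩_{AA'}}` of pure bipartite states: a probability distribution on the
finite alphabet `X` and, for each letter, a unit vector of `ℂ^A ⊗ ℂ^α`, where `α` indexes a basis
of the channel input `A'` and `A` a basis of the reference system. -/
structure PureEnsemble (X A α : Type) [Fintype X] [Fintype A] [Fintype α] where
  prob : X → ℝ
  prob_nonneg : ∀ x, 0 ≤ prob x
  prob_sum : ∑ x, prob x = 1
  vec : X → A × α → ℂ
  vec_norm : ∀ x, ∑ s, ‖vec x s‖ ^ 2 = 1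

namespace PureEnsemble

variable {X A α : Type} [Fintype X] [Fintype A] [Fintype α]

/-- The rank-one projection `|φˣ⟩⟨φˣ|` on `A ⊗ A'`. -/
def proj (e : PureEnsemble X A α) (x : X) : Matrix (A × α) (A × α) ℂ :=
  Matrix.vecMulVec (e.vec x) (star (e.vec x))

/-- The channel input state `ρˣ_{A'} = Tr_A |φˣ⟩⟨φˣ|`, of which `|φˣ⟩` is a purification. -/
def inputState (e : PureEnsemble X A α) (x : X) : Matrix α α ℂ :=
  Matrix.of fun i j => ∑ a, e.proj x (a, i) (a, j)

open Classical in
/-- The classical-quantum state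
`ρ_{XAB} = ∑ₓ p_X(x) |x⟩⟨x|_X ⊗ (id_A ⊗ N_{A'→B})(|φˣ⟩⟨φˣ|_{AA'})`. -/
def cqState {β : Type} (e : PureEnsemble X A α) (N : Matrix α α ℂ →ₗ[ℂ] Matrix β β ℂ) :
    Matrix (X × A × β) (X × A × β) ℂ :=
  ∑ x, (e.prob x : ℂ) • (Matrix.single x x (1 : ℂ) ⊗ₖ idTensor N (e.proj x))

end PureEnsemble

section Marginals

variable {X A B : Type} [Fintype X] [Fintype A] [Fintype B]

/-- Reduced state on `X`. -/
def margX (ρ : Matrix (X × A × B) (X × A × B) ℂ) : Matrix X X ℂ :=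
  Matrix.of fun x x' => ∑ a, ∑ b, ρ (x, a, b) (x', a, b)

/-- Reduced state on `B`. -/
def margB (ρ : Matrix (X × A × B) (X × A × B) ℂ) : Matrix B B ℂ :=
  Matrix.of fun b b' => ∑ x, ∑ a, ρ (x, a, b) (x, a, b')

/-- Reduced state on `AX`. -/
def margAX (ρ : Matrix (X × A × B) (X × A × B) ℂ) : Matrix (X × A) (X × A) ℂ :=
  Matrix.of fun s t => ∑ b, ρ (s.1, s.2, b) (t.1, t.2, b)

/-- Reduced state on `BX`. -/
def margBX (ρ : Matrix (X × A × B) (X × A × B) ℂ) : Matrix (X × B) (X × B) ℂ :=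
  Matrix.of fun s t => ∑ a, ρ (s.1, a, s.2) (t.1, a, t.2)

/-- Quantum mutual information `I(AX;B) = H(AX) + H(B) - H(ABX)`. -/
def mutualInfoAXB (ρ : Matrix (X × A × B) (X × A × B) ℂ) : ℝ :=
  vonNeumannEntropy (margAX ρ) + vonNeumannEntropy (margB ρ) - vonNeumannEntropy ρ

/-- Coherent information `I(A⟩BX) = H(BX) - H(ABX)`. -/
def coherentInfo (ρ : Matrix (X × A × B) (X × A × B) ℂ) : ℝ :=
  vonNeumannEntropy (margBX ρ) - vonNeumannEntropy ρ

/-- Holevo information `I(X;B) = H(X) + H(B) - H(BX)`. -/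
def holevoInfo (ρ : Matrix (X × A × B) (X × A × B) ℂ) : ℝ :=
  vonNeumannEntropy (margX ρ) + vonNeumannEntropy (margB ρ) - vonNeumannEntropy (margBX ρ)

end Marginals

/-- The polyhedron of rate triples `(C, Q, E)` with
`C + 2Q ≤ a`, `Q + E ≤ b`, `C + Q + E ≤ c`. -/
def ratePolyhedron (a b c : ℝ) : Set (ℝ × ℝ × ℝ) :=
  {r | r.1 + 2 * r.2.1 ≤ a ∧ r.2.1 + r.2.2 ≤ b ∧ r.1 + r.2.1 + r.2.2 ≤ c}

/-- The polyhedron of an ensemble used over the channel `N`: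
`C + 2Q ≤ I(AX;B)`, `Q + E ≤ I(A⟩BX)`, `C + Q + E ≤ I(X;B) + I(A⟩BX)`. -/
def PureEnsemble.polyhedron {X A α β : Type} [Fintype X] [Fintype A] [Fintype α] [Fintype β]
    (e : PureEnsemble X A α) (N : Matrix α α ℂ →ₗ[ℂ] Matrix β β ℂ) : Set (ℝ × ℝ × ℝ) :=
  ratePolyhedron (mutualInfoAXB (e.cqState N)) (coherentInfo (e.cqState N))
    (holevoInfo (e.cqState N) + coherentInfo (e.cqState N))

/-- The single-letter triple trade-off region of `N`: the union of the polyhedra of all ensembles,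
over all finite alphabets and all finite-dimensional reference systems. -/
def tripleTradeoffRegion {α β : Type} [Fintype α] [Fintype β]
    (N : Matrix α α ℂ →ₗ[ℂ] Matrix β β ℂ) : Set (ℝ × ℝ × ℝ) :=
  ⋃ (n : ℕ) (d : ℕ) (e : PureEnsemble (Fin n) (Fin d) α), e.polyhedron N

/-- The qubit state with `⟨0|ρ|0⟩ = p`, `⟨1|ρ|1⟩ = 1 - p` and `⟨0|ρ|1⟩ = ⟨1|ρ|0⟩ = c`; in the
ordered basis `(|1⟩, |0⟩)` it reads `(1-p, c; c, p)`. -/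
def qubitState (p c : ℝ) : Matrix (Fin 2) (Fin 2) ℂ :=
  !![(p : ℂ), (c : ℂ); (c : ℂ), ((1 - p : ℝ) : ℂ)]

/-- `e` is (a purification of) the symmetric ensemble
`½ |0⟩⟨0|_X ⊗ ρ₊ + ½ |1⟩⟨1|_X ⊗ ρ₋`, where `ρ_±` has populations `p`, `1 - p` and coherence
`±ν √(p(1-p))`. -/
def PureEnsemble.IsSymmetric {A : Type} [Fintype A] (e : PureEnsemble (Fin 2) A (Fin 2))
    (p ν : ℝ) : Prop :=
  (∀ x, e.prob x = 1 / 2) ∧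
  e.inputState 0 = qubitState p (ν * Real.sqrt (p * (1 - p))) ∧
  e.inputState 1 = qubitState p (-(ν * Real.sqrt (p * (1 - p))))

end

section MonotoneLHopital

variable {f g f' g' : ℝ → ℝ} {a : ℝ}

theorem pos_of_hasDerivAt_pos (hgc : ContinuousOn g (Set.Ici a))
    (hg : ∀ x, a < x → HasDerivAt g (g' x) x) (hga : g a = 0) (hg' : ∀ x, a < x → 0 < g' x)
    {x : ℝ} (hx : a < x) : 0 < g x := by
  have hmono : StrictMonoOn g (Set.Ici a) := by
    refine strictMonoOn_of_deriv_pos (convex_Ici a) hgc fun y hy => ?_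
    rw [interior_Ici] at hy
    exact (hg y hy).deriv ▸ hg' y hy
  exact hga ▸ hmono Set.self_mem_Ici hx.le hx

theorem exists_div_eq_deriv_div
    (hfc : ContinuousOn f (Set.Ici a)) (hgc : ContinuousOn g (Set.Ici a))
    (hf : ∀ x, a < x → HasDerivAt f (f' x) x) (hg : ∀ x, a < x → HasDerivAt g (g' x) x)
    (hfa : f a = 0) (hga : g a = 0) (hg' : ∀ x, a < x → 0 < g' x) {x : ℝ} (hx : a < x) :
    ∃ c ∈ Set.Ioo a x, f x / g x = f' c / g' c := by
  obtain ⟨c, hc, h⟩ := exists_ratio_hasDerivAt_eq_ratio_slope f f' hx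
    (hfc.mono Set.Icc_subset_Ici_self) (fun y hy => hf y hy.1) g g'
    (hgc.mono Set.Icc_subset_Ici_self) (fun y hy => hg y hy.1)
  refine ⟨c, hc, ?_⟩
  rw [div_eq_div_iff (pos_of_hasDerivAt_pos hgc hg hga hg' hx).ne' (hg' c hc.1).ne']
  simpa [hfa, hga, mul_comm] using h.symm

theorem monotoneOn_div_of_monotoneOn_deriv_div
    (hfc : ContinuousOn f (Set.Ici a)) (hgc : ContinuousOn g (Set.Ici a))
    (hf : ∀ x, a < x → HasDerivAt f (f' x) x) (hg : ∀ x, a < x → HasDerivAt g (g' x) x)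
    (hfa : f a = 0) (hga : g a = 0) (hg' : ∀ x, a < x → 0 < g' x)
    (hmono : MonotoneOn (fun x => f' x / g' x) (Set.Ioi a)) :
    MonotoneOn (fun x => f x / g x) (Set.Ioi a) := by
  have hpos : ∀ x, a < x → 0 < g x := fun x => pos_of_hasDerivAt_pos hgc hg hga hg'
  have hderiv : ∀ x, a < x → HasDerivAt (fun x => f x / g x)
      (g' x / g x * (f' x / g' x - f x / g x)) x := fun x hx => by
    refine ((hf x hx).div (hg x hx) (hpos x hx).ne').congr_deriv ?_
    have := (hpos x hx).ne'
    have := (hg' x hx).ne'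
    field_simp
  refine monotoneOn_of_deriv_nonneg (convex_Ioi a)
    (fun x hx => (hderiv x hx).continuousAt.continuousWithinAt)
    (fun x hx => (hderiv x (interior_subset hx)).differentiableAt.differentiableWithinAt)
    fun x hx => ?_
  rw [interior_Ioi] at hx
  obtain ⟨c, hc, hfg⟩ := exists_div_eq_deriv_div hfc hgc hf hg hfa hga hg' hx
  rw [(hderiv x hx).deriv, hfg]
  exact mul_nonneg (div_pos (hg' x hx) (hpos x hx)).le
    (sub_nonneg.2 (hmono (Set.mem_Ioi.2 hc.1) hx hc.2.le))

end MonotoneLHopital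

section Hyperbolic

open Real

theorem one_sub_tanh_sq (x : ℝ) : 1 - tanh x ^ 2 = (cosh x ^ 2)⁻¹ := by
  rw [tanh_eq_sinh_div_cosh, div_pow, sinh_sq]
  field_simp [(cosh_pos x).ne']
  ring

theorem hasDerivAt_tanh (x : ℝ) : HasDerivAt tanh (1 - tanh x ^ 2) x := by
  have h := (hasDerivAt_sinh x).div (hasDerivAt_cosh x) (cosh_pos x).ne'
  rw [show tanh = fun y => sinh y / cosh y from funext tanh_eq_sinh_div_cosh]
  refine h.congr_deriv ?_
  field_simp [(cosh_pos x).ne']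

theorem hasDerivAt_artanh {r : ℝ} (hr : r ∈ Set.Ioo (-1) 1) :
    HasDerivAt artanh (1 - r ^ 2)⁻¹ r := by
  have hsum : 1 + r ≠ 0 := by linarith [hr.1]
  have hdiff : 1 - r ≠ 0 := by linarith [hr.2]
  have hlog : HasDerivAt (fun r => 1 / 2 * log ((1 + r) / (1 - r))) (1 - r ^ 2)⁻¹ r := by
    have h := ((((hasDerivAt_id r).const_add 1).fun_div ((hasDerivAt_id r).const_sub 1) hdiff).log
      (div_ne_zero hsum hdiff)).const_mul (1 / 2)
    refine h.congr_deriv ?_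
    rw [show 1 - r ^ 2 = (1 + r) * (1 - r) by ring]
    simp only [id]
    field_simp
    ring
  exact hlog.congr_of_eventuallyEq
    (by filter_upwards [isOpen_Ioo.mem_nhds hr] with y hy using
      artanh_eq_half_log (Set.Ioo_subset_Icc_self hy))

theorem tanh_mul_exp_two_mul_add_one (x : ℝ) :
    tanh x * (exp (2 * x) + 1) = exp (2 * x) - 1 := by
  rw [tanh_eq_sinh_div_cosh, sinh_eq, cosh_eq, exp_neg, two_mul, exp_add]
  field_simp

theorem hasDerivAt_exp_mul (c x : ℝ) : HasDerivAt (fun x => exp (c * x)) (c * exp (c * x)) x := by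
  simpa [mul_comm] using ((hasDerivAt_id x).const_mul c).exp

theorem hasDerivAt_sinh_two_mul_sub (x : ℝ) :
    HasDerivAt (fun x => sinh (2 * x) - 2 * x) (2 * cosh (2 * x) - 2) x := by
  have h := (hasDerivAt_id x).const_mul 2
  simpa [mul_comm] using h.sinh.fun_sub h

theorem two_mul_cosh_two_mul_sub_two (x : ℝ) : 2 * cosh (2 * x) - 2 = 4 * sinh x ^ 2 := by
  rw [cosh_two_mul, cosh_sq]; ring

theorem two_mul_cosh_two_mul_sub_two_pos {x : ℝ} (hx : 0 < x) : 0 < 2 * cosh (2 * x) - 2 := by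
  have := sinh_pos_iff.2 hx
  rw [two_mul_cosh_two_mul_sub_two]
  positivity

theorem sinh_two_mul_sub_pos {x : ℝ} (hx : 0 < x) : 0 < sinh (2 * x) - 2 * x :=
  pos_of_hasDerivAt_pos (by fun_prop) (fun x _ => hasDerivAt_sinh_two_mul_sub x) (by simp)
    (fun _ => two_mul_cosh_two_mul_sub_two_pos) hx

theorem hasDerivAt_sub_tanh (x : ℝ) : HasDerivAt (fun x => x - tanh x) (tanh x ^ 2) x := by
  simpa using (hasDerivAt_id x).fun_sub (hasDerivAt_tanh x)

theorem continuous_sub_tanh : Continuous fun x => x - tanh x :=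
  continuous_iff_continuousAt.2 fun x => (hasDerivAt_sub_tanh x).continuousAt

theorem tanh_sq_pos {x : ℝ} (hx : 0 < x) : 0 < tanh x ^ 2 := by
  have := div_pos (sinh_pos_iff.2 hx) (cosh_pos x)
  rw [tanh_eq_sinh_div_cosh]
  positivity

theorem sub_tanh_pos {x : ℝ} (hx : 0 < x) : 0 < x - tanh x :=
  pos_of_hasDerivAt_pos continuous_sub_tanh.continuousOn (fun x _ => hasDerivAt_sub_tanh x)
    (by simp) (fun _ => tanh_sq_pos) hx

theorem monotoneOn_sinh_two_mul_sub_div_sub_tanh :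
    MonotoneOn (fun x => (sinh (2 * x) - 2 * x) / (x - tanh x)) (Set.Ioi 0) := by
  refine monotoneOn_div_of_monotoneOn_deriv_div (by fun_prop) continuous_sub_tanh.continuousOn
    (fun x _ => hasDerivAt_sinh_two_mul_sub x) (fun x _ => hasDerivAt_sub_tanh x) (by simp)
    (by simp) (fun _ => tanh_sq_pos) ?_
  have hratio : Set.EqOn (fun x => 4 * cosh x ^ 2)
      (fun x => (2 * cosh (2 * x) - 2) / tanh x ^ 2) (Set.Ioi 0) := fun x hx => by
    have := (sinh_pos_iff.2 hx).ne'
    simp only [two_mul_cosh_two_mul_sub_two, tanh_eq_sinh_div_cosh]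
    field_simp [(cosh_pos x).ne']
  refine MonotoneOn.congr (fun x hx y _ hxy => ?_) hratio
  have hcosh : cosh x ≤ cosh y :=
    cosh_le_cosh.2 (abs_le_abs_of_nonneg (le_of_lt hx) hxy)
  have := cosh_pos x
  gcongr

theorem monotoneOn_mul_exp_div_sinh :
    MonotoneOn (fun x => x * exp (2 * x) / sinh (2 * x)) (Set.Ioi 0) := by
  have hratio : Set.EqOn (fun x => 2 * x / (1 - exp (-4 * x)))
      (fun x => x * exp (2 * x) / sinh (2 * x)) (Set.Ioi 0) := fun x _ => by
    simp only [sinh_eq]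
    rw [show exp (-4 * x) = exp (-(2 * x)) / exp (2 * x) by rw [← exp_sub]; ring_nf]
    field_simp
  refine MonotoneOn.congr ?_ hratio
  refine monotoneOn_div_of_monotoneOn_deriv_div (f' := fun _ => 2)
    (g' := fun x => 4 * exp (-4 * x)) (by fun_prop) (by fun_prop)
    (fun x _ => by simpa using (hasDerivAt_id x).const_mul 2)
    (fun x _ => by simpa using (hasDerivAt_exp_mul (-4) x).const_sub 1) (by simp) (by simp)
    (fun x _ => by positivity) fun x _ y _ hxy => ?_
  have hexp (x : ℝ) : 2 / (4 * exp (-4 * x)) = exp (4 * x) / 2 := by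
    rw [neg_mul, exp_neg]
    field_simp
    norm_num
  simp only [hexp]
  gcongr

theorem monotoneOn_exp_add_div_sinh_sub :
    MonotoneOn (fun x => (x * (exp (2 * x) + 1) - exp (2 * x) + 1) / (sinh (2 * x) - 2 * x))
      (Set.Ioi 0) := by
  refine monotoneOn_div_of_monotoneOn_deriv_div
    (f' := fun x => 1 + (2 * x - 1) * exp (2 * x)) (by fun_prop) (by fun_prop)
    (fun x _ => ?_) (fun x _ => hasDerivAt_sinh_two_mul_sub x) (by simp) (by simp)
    (fun _ => two_mul_cosh_two_mul_sub_two_pos) ?_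
  · refine ((((hasDerivAt_id x).mul ((hasDerivAt_exp_mul 2 x).add_const 1)).sub
      (hasDerivAt_exp_mul 2 x)).add_const 1).congr_deriv ?_
    simp only [id]
    ring
  refine monotoneOn_div_of_monotoneOn_deriv_div (f' := fun x => 4 * x * exp (2 * x))
    (g' := fun x => 4 * sinh (2 * x)) (by fun_prop) (by fun_prop) (fun x _ => ?_) (fun x _ => ?_)
    (by simp) (by simp) (fun x hx => by simpa using hx) ?_
  · refine (((((hasDerivAt_id x).const_mul 2).sub_const 1).mul
      (hasDerivAt_exp_mul 2 x)).const_add 1).congr_deriv ?_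
    simp only [id]
    ring
  · refine (((((hasDerivAt_id x).const_mul 2).cosh).const_mul 2).sub_const 2).congr_deriv ?_
    simp only [id]
    ring
  · simpa only [mul_assoc, ne_eq, OfNat.ofNat_ne_zero, not_false_eq_true, mul_div_mul_left]
      using monotoneOn_mul_exp_div_sinh

end Hyperbolic

section QubitEntropy

open Real

/-- The excess `θ - 2 * y` of `qubitEntropyRatio`, as a function of the length `r = √(1 - y)` of
the Bloch vector. -/
noncomputable def entropyCurvature (r : ℝ) : ℝ :=
  2 * (1 - r ^ 2) * (artanh r - r) / (r - (1 - r ^ 2) * artanh r)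

theorem tanh_sub_one_sub_tanh_sq_mul (x : ℝ) :
    tanh x - (1 - tanh x ^ 2) * x = (sinh (2 * x) - 2 * x) / 2 * (1 - tanh x ^ 2) := by
  rw [one_sub_tanh_sq, tanh_eq_sinh_div_cosh, sinh_two_mul]
  field_simp [(cosh_pos x).ne']

theorem sub_one_sub_sq_mul_artanh_pos {r : ℝ} (hr : r ∈ Set.Ioo 0 1) :
    0 < r - (1 - r ^ 2) * artanh r := by
  have htanh : tanh (artanh r) = r := tanh_artanh ⟨by linarith [hr.1], hr.2⟩
  have h := tanh_sub_one_sub_tanh_sq_mul (artanh r)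
  rw [htanh] at h
  rw [h]
  have := sinh_two_mul_sub_pos (artanh_pos hr)
  have : 0 < 1 - r ^ 2 := by nlinarith [hr.1, hr.2]
  positivity

theorem entropyCurvature_tanh (x : ℝ) :
    entropyCurvature (tanh x) = 4 * ((x - tanh x) / (sinh (2 * x) - 2 * x)) := by
  have hne : 1 - tanh x ^ 2 ≠ 0 := by
    rw [one_sub_tanh_sq]
    exact inv_ne_zero (pow_ne_zero 2 (cosh_pos x).ne')
  rw [entropyCurvature, artanh_tanh, tanh_sub_one_sub_tanh_sq_mul, mul_comm (_ / 2),
    mul_comm 2, mul_assoc, mul_div_mul_left _ _ hne]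
  field_simp
  ring

theorem monotoneOn_artanh : MonotoneOn artanh (Set.Ioo 0 1) := fun _ hx _ hy hxy =>
  artanh_le_artanh (by linarith [hx.1]) hy.2 hxy

theorem antitoneOn_entropyCurvature : AntitoneOn entropyCurvature (Set.Ioo 0 1) := by
  intro r hr r' hr' hle
  have hmono := monotoneOn_sinh_two_mul_sub_div_sub_tanh (artanh_pos hr) (artanh_pos hr')
    (monotoneOn_artanh hr hr' hle)
  have := sub_tanh_pos (artanh_pos hr)
  have := sinh_two_mul_sub_pos (artanh_pos hr)
  simp only at hmono
  rw [← tanh_artanh (Set.Ioo_subset_Ioo_left neg_one_lt_zero.le hr),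
    ← tanh_artanh (Set.Ioo_subset_Ioo_left neg_one_lt_zero.le hr'), entropyCurvature_tanh,
    entropyCurvature_tanh, ← inv_div, ← inv_div (sinh _ - _)]
  gcongr

theorem entropyCurvature_tanh_div_one_sub (x : ℝ) :
    entropyCurvature (tanh x) / (1 - tanh x) =
      2 * ((x * (exp (2 * x) + 1) - exp (2 * x) + 1) / (sinh (2 * x) - 2 * x)) := by
  have hne : 1 - tanh x ≠ 0 := (sub_pos.2 (tanh_lt_one x)).ne'
  rw [entropyCurvature_tanh, div_eq_iff hne, mul_assoc, div_mul_eq_mul_div, ← mul_div_assoc,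
    ← mul_div_assoc]
  congr 1
  linear_combination (2 * x - 2) * tanh_mul_exp_two_mul_add_one x

theorem monotoneOn_entropyCurvature_div_one_sub :
    MonotoneOn (fun r => entropyCurvature r / (1 - r)) (Set.Ioo 0 1) := by
  intro r hr r' hr' hle
  have hmono := monotoneOn_exp_add_div_sinh_sub (artanh_pos hr) (artanh_pos hr')
    (monotoneOn_artanh hr hr' hle)
  simp only at hmono ⊢
  rw [← tanh_artanh (Set.Ioo_subset_Ioo_left neg_one_lt_zero.le hr),
    ← tanh_artanh (Set.Ioo_subset_Ioo_left neg_one_lt_zero.le hr'),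
    entropyCurvature_tanh_div_one_sub, entropyCurvature_tanh_div_one_sub]
  gcongr

theorem mul_entropyCurvature_le {r r' s : ℝ} (hr : r ∈ Set.Ioo 0 1) (hs : s ∈ Set.Ioc 0 1)
    (hr'pos : 0 < r') (hr' : r' ≤ 1 - s * (1 - r)) :
    s * entropyCurvature r ≤ entropyCurvature r' := by
  obtain ⟨hr0, hr1⟩ := hr
  obtain ⟨hs0, hs1⟩ := hs
  have hle : r ≤ 1 - s * (1 - r) := by nlinarith
  have hmem : 1 - s * (1 - r) ∈ Set.Ioo 0 1 := ⟨hr0.trans_le hle, by nlinarith⟩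
  have hdiv := monotoneOn_entropyCurvature_div_one_sub ⟨hr0, hr1⟩ hmem hle
  simp only [sub_sub_cancel] at hdiv
  rw [div_le_div_iff₀ (by linarith) (by nlinarith)] at hdiv
  calc s * entropyCurvature r ≤ entropyCurvature (1 - s * (1 - r)) :=
        le_of_mul_le_mul_right (by linarith) (sub_pos.2 hr1)
    _ ≤ entropyCurvature r' :=
        antitoneOn_entropyCurvature ⟨hr'pos, hr'.trans_lt hmem.2⟩ hmem hr'

/-- Entropy, in nats, of a qubit state whose determinant is `y / 4`. -/
noncomputable def qubitEntropy (y : ℝ) : ℝ := binEntropy ((1 + √(1 - y)) / 2)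

/-- The derivative of `qubitEntropy` on `(0, 1)`. -/
noncomputable def qubitEntropyDeriv (y : ℝ) : ℝ := artanh √(1 - y) / (2 * √(1 - y))

/-- The ratio `θ = -f' / f''` for `f = qubitEntropy` on `(0, 1)`. -/
noncomputable def qubitEntropyRatio (y : ℝ) : ℝ := entropyCurvature √(1 - y) + 2 * y

theorem continuous_qubitEntropy : Continuous qubitEntropy := by
  unfold qubitEntropy
  fun_prop

theorem qubitEntropy_zero : qubitEntropy 0 = 0 := by simp [qubitEntropy]

theorem qubitEntropy_one : qubitEntropy 1 = log 2 := by simp [qubitEntropy]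

theorem qubitEntropy_four_mul (q : ℝ) : qubitEntropy (4 * q * (1 - q)) = binEntropy q := by
  rw [qubitEntropy, show 1 - 4 * q * (1 - q) = (2 * q - 1) ^ 2 by ring, sqrt_sq_eq_abs]
  rcases abs_cases (2 * q - 1) with ⟨h, -⟩ | ⟨h, -⟩
  · rw [h]; congr 1; ring
  · rw [h, ← binEntropy_one_sub]; congr 1; ring

theorem strictMonoOn_qubitEntropy : StrictMonoOn qubitEntropy (Set.Icc 0 1) := by
  intro x hx y hy hxy
  have hlt : √(1 - y) < √(1 - x) := sqrt_lt_sqrt (by linarith [hy.2]) (by linarith)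
  have hle : √(1 - x) ≤ 1 := sqrt_le_one.2 (by linarith [hx.1])
  have hnonneg := sqrt_nonneg (1 - y)
  exact binEntropy_strictAntiOn ⟨by linarith, by linarith⟩ ⟨by linarith, by linarith⟩
    (by linarith)

theorem monotoneOn_qubitEntropy : MonotoneOn qubitEntropy (Set.Icc 0 1) :=
  strictMonoOn_qubitEntropy.monotoneOn

variable {y : ℝ}

theorem sqrt_one_sub_mem_Ioo (hy : y ∈ Set.Ioo 0 1) : √(1 - y) ∈ Set.Ioo 0 1 :=
  ⟨sqrt_pos.2 (sub_pos.2 hy.2), by rw [sqrt_lt' one_pos]; linarith [hy.1]⟩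

theorem one_sub_sqrt_one_sub_sq (hy : y ≤ 1) : 1 - √(1 - y) ^ 2 = y := by
  rw [sq_sqrt (sub_nonneg.2 hy), sub_sub_cancel]

theorem hasDerivAt_sqrt_one_sub (hy : y < 1) :
    HasDerivAt (fun y => √(1 - y)) (-1 / (2 * √(1 - y))) y :=
  ((hasDerivAt_id y).const_sub 1).sqrt (sub_pos.2 hy).ne'

theorem hasDerivAt_qubitEntropy (hy : y ∈ Set.Ioo 0 1) :
    HasDerivAt qubitEntropy (qubitEntropyDeriv y) y := by
  obtain ⟨hr0, hr1⟩ := sqrt_one_sub_mem_Ioo hy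
  have h := (hasDerivAt_binEntropy (p := (1 + √(1 - y)) / 2) (by positivity)
    (by linarith)).comp y (((hasDerivAt_sqrt_one_sub hy.2).const_add 1).div_const 2)
  refine h.congr_deriv ?_
  rw [qubitEntropyDeriv, artanh_eq_half_log ⟨by linarith, hr1.le⟩,
    log_div (by linarith) (sub_pos.2 hr1).ne',
    show 1 - (1 + √(1 - y)) / 2 = (1 - √(1 - y)) / 2 by ring,
    log_div (sub_pos.2 hr1).ne' (by norm_num), log_div (by linarith) (by norm_num)]
  field_simp
  ring

theorem qubitEntropyDeriv_pos (hy : y ∈ Set.Ioo 0 1) : 0 < qubitEntropyDeriv y := by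
  have hr := sqrt_one_sub_mem_Ioo hy
  exact div_pos (artanh_pos hr) (mul_pos two_pos hr.1)

theorem sqrt_one_sub_sub_mul_artanh_pos (hy : y ∈ Set.Ioo 0 1) :
    0 < √(1 - y) - y * artanh √(1 - y) := by
  simpa only [one_sub_sqrt_one_sub_sq hy.2.le] using
    sub_one_sub_sq_mul_artanh_pos (sqrt_one_sub_mem_Ioo hy)

theorem qubitEntropyRatio_eq (hy : y ∈ Set.Ioo 0 1) :
    qubitEntropyRatio y =
      2 * artanh √(1 - y) * √(1 - y) ^ 2 * y / (√(1 - y) - y * artanh √(1 - y)) := by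
  rw [qubitEntropyRatio, entropyCurvature, one_sub_sqrt_one_sub_sq hy.2.le,
    div_add' _ _ _ (sqrt_one_sub_sub_mul_artanh_pos hy).ne']
  congr 1
  rw [sq_sqrt (sub_pos.2 hy.2).le]
  ring

theorem qubitEntropyRatio_pos (hy : y ∈ Set.Ioo 0 1) : 0 < qubitEntropyRatio y := by
  rw [qubitEntropyRatio_eq hy]
  have hr := sqrt_one_sub_mem_Ioo hy
  have := artanh_pos hr
  have := hr.1
  have := hy.1
  have := sqrt_one_sub_sub_mul_artanh_pos hy
  positivity

theorem hasDerivAt_qubitEntropyDeriv (hy : y ∈ Set.Ioo 0 1) :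
    HasDerivAt qubitEntropyDeriv (-(qubitEntropyDeriv y / qubitEntropyRatio y)) y := by
  obtain ⟨hr0, hr1⟩ := sqrt_one_sub_mem_Ioo hy
  have hsqrt := hasDerivAt_sqrt_one_sub hy.2
  have h := ((hasDerivAt_artanh ⟨by linarith, hr1⟩).comp y hsqrt).div (hsqrt.const_mul 2)
    (by positivity)
  refine h.congr_deriv ?_
  have := (artanh_pos ⟨hr0, hr1⟩).ne'
  have := (sqrt_one_sub_sub_mul_artanh_pos hy).ne'
  have := hy.1.ne'
  rw [qubitEntropyRatio_eq hy, qubitEntropyDeriv, one_sub_sqrt_one_sub_sq hy.2.le]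
  simp only [Function.comp]
  field_simp
  ring

end QubitEntropy

section Convexity

open Real

theorem convexOn_of_comp_lineMap {E : Type*} [AddCommGroup E] [Module ℝ E] {s : Set E} {f : E → ℝ}
    (hs : Convex ℝ s)
    (hf : ∀ x ∈ s, ∀ y ∈ s, ConvexOn ℝ (Set.Icc 0 1) fun t : ℝ => f (AffineMap.lineMap x y t)) :
    ConvexOn ℝ s f := by
  refine ⟨hs, fun x hx y hy a b ha hb hab => ?_⟩
  have h := (hf x hx y hy).2 (Set.left_mem_Icc.2 zero_le_one) (Set.right_mem_Icc.2 zero_le_one)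
    ha hb hab
  obtain rfl : a = 1 - b := by linarith
  simpa [AffineMap.lineMap_apply_module] using h

theorem convexOn_closure {E : Type*} [AddCommGroup E] [Module ℝ E] [TopologicalSpace E]
    [IsTopologicalAddGroup E] [ContinuousConstSMul ℝ E] {s : Set E} {f : E → ℝ}
    (hf : ConvexOn ℝ s f) (hcont : Continuous f) : ConvexOn ℝ (closure s) f := by
  refine ⟨hf.1.closure, fun x hx y hy a b ha hb hab => ?_⟩
  have hclosed : IsClosed {p : E × E | f (a • p.1 + b • p.2) ≤ a • f p.1 + b • f p.2} :=
    isClosed_le (by fun_prop) (by fun_prop)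
  have hsubset : s ×ˢ s ⊆ {p : E × E | f (a • p.1 + b • p.2) ≤ a • f p.1 + b • f p.2} :=
    fun p hp => hf.2 hp.1 hp.2 ha hb hab
  have hmem : (x, y) ∈ closure (s ×ˢ s) := by
    rw [closure_prod_eq]
    exact ⟨hx, hy⟩
  exact closure_minimal hsubset hclosed hmem

theorem convexOn_qubitEntropy_comp {s : Set ℝ} {z z' z'' : ℝ → ℝ} (hs : Convex ℝ s)
    (hmem : ∀ t ∈ s, z t ∈ Set.Ioo 0 1) (hz : ∀ t ∈ s, HasDerivAt z (z' t) t)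
    (hz' : ∀ t ∈ s, HasDerivAt z' (z'' t) t)
    (hle : ∀ t ∈ s, z' t ^ 2 / qubitEntropyRatio (z t) ≤ z'' t) :
    ConvexOn ℝ s fun t => qubitEntropy (z t) := by
  refine convexOn_of_hasDerivWithinAt2_nonneg hs (f' := fun t => qubitEntropyDeriv (z t) * z' t)
    (f'' := fun t => qubitEntropyDeriv (z t) * (z'' t - z' t ^ 2 / qubitEntropyRatio (z t)))
    (fun t ht => (continuous_qubitEntropy.continuousAt.comp
      (hz t ht).continuousAt).continuousWithinAt) ?_ ?_ ?_
  all_goals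
    intro t ht
    replace ht := interior_subset ht
  · exact ((hasDerivAt_qubitEntropy (hmem t ht)).comp t (hz t ht)).hasDerivWithinAt
  · refine ((((hasDerivAt_qubitEntropyDeriv (hmem t ht)).comp t (hz t ht)).mul
      (hz' t ht)).congr_deriv ?_).hasDerivWithinAt
    simp only [Function.comp]
    ring
  · exact mul_nonneg (qubitEntropyDeriv_pos (hmem t ht)).le (sub_nonneg.2 (hle t ht))

theorem qubitEntropy_mem_Icc {y : ℝ} (hy : y ∈ Set.Icc 0 1) :
    qubitEntropy y ∈ Set.Icc 0 (log 2) :=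
  ⟨qubitEntropy_zero ▸ monotoneOn_qubitEntropy (Set.left_mem_Icc.2 zero_le_one) hy hy.1,
    binEntropy_le_log_two⟩

theorem surjective_qubitEntropy_restrict :
    Function.Surjective fun y : Set.Icc (0 : ℝ) 1 =>
      (⟨qubitEntropy y, qubitEntropy_mem_Icc y.2⟩ : Set.Icc 0 (log 2)) := by
  rintro ⟨v, hv⟩
  have hivt := intermediate_value_Icc zero_le_one continuous_qubitEntropy.continuousOn
  rw [qubitEntropy_zero, qubitEntropy_one] at hivt
  obtain ⟨y, hy, rfl⟩ := hivt hv
  exact ⟨⟨y, hy⟩, rfl⟩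

/-- `qubitEntropy` as an order isomorphism from `[0, 1]` onto its range `[0, log 2]`. -/
noncomputable def qubitEntropyOrderIso : Set.Icc (0 : ℝ) 1 ≃o Set.Icc 0 (log 2) :=
  StrictMono.orderIsoOfSurjective _
    (fun a b hab => strictMonoOn_qubitEntropy a.2 b.2 hab) surjective_qubitEntropy_restrict

/-- The inverse of `qubitEntropy`, extended from `[0, log 2]` to `ℝ` by constants. -/
noncomputable def qubitEntropyInv : ℝ → ℝ :=
  Set.IccExtend (log_nonneg one_le_two) fun v => (qubitEntropyOrderIso.symm v : ℝ)

theorem continuous_qubitEntropyInv : Continuous qubitEntropyInv :=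
  (continuous_subtype_val.comp qubitEntropyOrderIso.symm.continuous).Icc_extend'

theorem qubitEntropyInv_mem_Icc (v : ℝ) : qubitEntropyInv v ∈ Set.Icc 0 1 :=
  (qubitEntropyOrderIso.symm _).2

theorem qubitEntropy_qubitEntropyInv {v : ℝ} (hv : v ∈ Set.Icc 0 (log 2)) :
    qubitEntropy (qubitEntropyInv v) = v := by
  rw [qubitEntropyInv, Set.IccExtend_of_mem _ _ hv]
  exact congrArg Subtype.val (qubitEntropyOrderIso.apply_symm_apply ⟨v, hv⟩)

theorem qubitEntropyInv_qubitEntropy {y : ℝ} (hy : y ∈ Set.Icc 0 1) :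
    qubitEntropyInv (qubitEntropy y) = y :=
  strictMonoOn_qubitEntropy.injOn (qubitEntropyInv_mem_Icc _) hy
    (qubitEntropy_qubitEntropyInv (qubitEntropy_mem_Icc hy))

theorem qubitEntropy_le_iff_le_qubitEntropyInv {y v : ℝ} (hy : y ∈ Set.Icc 0 1)
    (hv : v ∈ Set.Icc 0 (log 2)) : qubitEntropy y ≤ v ↔ y ≤ qubitEntropyInv v := by
  rw [← strictMonoOn_qubitEntropy.le_iff_le hy (qubitEntropyInv_mem_Icc v),
    qubitEntropy_qubitEntropyInv hv]

theorem qubitEntropyInv_mem_Ioo {v : ℝ} (hv : v ∈ Set.Ioo 0 (log 2)) :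
    qubitEntropyInv v ∈ Set.Ioo 0 1 := by
  have heq := qubitEntropy_qubitEntropyInv (Set.Ioo_subset_Icc_self hv)
  obtain ⟨h0, h1⟩ := qubitEntropyInv_mem_Icc v
  refine ⟨h0.lt_of_ne fun h => hv.1.ne ?_, h1.lt_of_ne fun h => hv.2.ne ?_⟩
  · rw [← heq, ← h, qubitEntropy_zero]
  · rw [← heq, h, qubitEntropy_one]

theorem hasDerivAt_qubitEntropyInv {v : ℝ} (hv : v ∈ Set.Ioo 0 (log 2)) :
    HasDerivAt qubitEntropyInv (qubitEntropyDeriv (qubitEntropyInv v))⁻¹ v := by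
  have hy := qubitEntropyInv_mem_Ioo hv
  refine HasDerivAt.of_local_left_inverse continuous_qubitEntropyInv.continuousAt
    (hasDerivAt_qubitEntropy hy) (qubitEntropyDeriv_pos hy).ne' ?_
  filter_upwards [Icc_mem_nhds hv.1 hv.2] with w hw using qubitEntropy_qubitEntropyInv hw

theorem hasDerivAt_inv_qubitEntropyDeriv_qubitEntropyInv {v : ℝ} (hv : v ∈ Set.Ioo 0 (log 2)) :
    HasDerivAt (fun v => (qubitEntropyDeriv (qubitEntropyInv v))⁻¹)
      ((qubitEntropyDeriv (qubitEntropyInv v))⁻¹ ^ 2 / qubitEntropyRatio (qubitEntropyInv v))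
      v := by
  have hy := qubitEntropyInv_mem_Ioo hv
  have hne := (qubitEntropyDeriv_pos hy).ne'
  refine (((hasDerivAt_qubitEntropyDeriv hy).comp v (hasDerivAt_qubitEntropyInv hv)).inv
    hne).congr_deriv ?_
  simp only [Function.comp]
  field_simp

end Convexity

section Damping

open Real

/-- The action of the amplitude damping channel with transmissivity `s` on the pair `(P, y)` formed
by the population of `|0⟩` and four times the determinant of a qubit state. -/
def dampPair (s : ℝ) (q : ℝ × ℝ) : ℝ × ℝ :=
  (s * q.1, s * q.2 + 4 * s * (1 - s) * q.1 ^ 2)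

/-- The pairs `(P, y)` formed by a population and four times the determinant of a qubit state. -/
def qubitRegion : Set (ℝ × ℝ) :=
  {q | q.1 ∈ Set.Icc 0 1 ∧ q.2 ∈ Set.Icc 0 (4 * q.1 * (1 - q.1))}

/-- The pairs formed by a population and the entropy, in nats, of a qubit state, written as the
intersection of a hypograph and an epigraph to make its convexity immediate. -/
def qubitEntropyRegion : Set (ℝ × ℝ) :=
  {q | q.1 ∈ Set.Icc 0 1 ∧ q.2 ≤ binEntropy q.1} ∩ {q | q.1 ∈ Set.Icc 0 1 ∧ 0 ≤ q.2}

/-- The part of `qubitEntropyRegion` coming from states that are neither pure nor diagonal. -/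
def strictQubitEntropyRegion : Set (ℝ × ℝ) :=
  {q | q.1 ∈ Set.Icc 0 1 ∧ q.2 < binEntropy q.1} ∩ {q | q.1 ∈ Set.Icc 0 1 ∧ 0 < q.2}

/-- The entropy, in nats, after amplitude damping with transmissivity `s`, as a function of the
population and the entropy of the input. -/
noncomputable def dampedEntropy (s : ℝ) (q : ℝ × ℝ) : ℝ :=
  qubitEntropy (dampPair s (q.1, qubitEntropyInv q.2)).2

variable {s : ℝ} {q : ℝ × ℝ}

theorem dampPair_one (q : ℝ × ℝ) : dampPair 1 q = q := by simp [dampPair]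

theorem dampPair_dampPair (s z : ℝ) (q : ℝ × ℝ) :
    dampPair s (dampPair z q) = dampPair (s * z) q := by
  ext <;> simp only [dampPair] <;> ring

theorem snd_mem_Icc_of_mem_qubitRegion (hq : q ∈ qubitRegion) : q.2 ∈ Set.Icc 0 1 :=
  ⟨hq.2.1, hq.2.2.trans (by nlinarith [sq_nonneg (1 - 2 * q.1)])⟩

theorem dampPair_mem_qubitRegion (hs : s ∈ Set.Icc 0 1) (hq : q ∈ qubitRegion) :
    dampPair s q ∈ qubitRegion := by
  obtain ⟨⟨hP0, hP1⟩, hy0, hy1⟩ := hq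
  obtain ⟨hs0, hs1⟩ := hs
  have := sub_nonneg.2 hs1
  refine ⟨⟨by simp only [dampPair]; positivity, ?_⟩, by simp only [dampPair]; positivity, ?_⟩
  · simpa only [dampPair] using mul_le_one₀ hs1 hP0 hP1
  · simp only [dampPair]
    nlinarith [mul_le_mul_of_nonneg_left hy1 hs0]

theorem four_mul_mul_one_sub_mem_Icc {P : ℝ} (hP : P ∈ Set.Icc 0 1) :
    4 * P * (1 - P) ∈ Set.Icc 0 1 :=
  ⟨by nlinarith [hP.1, hP.2], by nlinarith [sq_nonneg (1 - 2 * P)]⟩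

theorem mem_qubitEntropyRegion_of_mem_qubitRegion (hq : q ∈ qubitRegion) :
    (q.1, qubitEntropy q.2) ∈ qubitEntropyRegion := by
  have hmem := snd_mem_Icc_of_mem_qubitRegion hq
  refine ⟨⟨hq.1, ?_⟩, hq.1, (qubitEntropy_mem_Icc hmem).1⟩
  rw [← qubitEntropy_four_mul]
  exact monotoneOn_qubitEntropy hmem (four_mul_mul_one_sub_mem_Icc hq.1) hq.2.2

theorem snd_mem_Icc_of_mem_qubitEntropyRegion (hq : q ∈ qubitEntropyRegion) :
    q.2 ∈ Set.Icc 0 (log 2) :=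
  ⟨hq.2.2, hq.1.2.trans binEntropy_le_log_two⟩

theorem mem_qubitRegion_of_mem_qubitEntropyRegion (hq : q ∈ qubitEntropyRegion) :
    (q.1, qubitEntropyInv q.2) ∈ qubitRegion := by
  refine ⟨hq.1.1, (qubitEntropyInv_mem_Icc _).1, ?_⟩
  rw [← strictMonoOn_qubitEntropy.le_iff_le (qubitEntropyInv_mem_Icc _)
    (four_mul_mul_one_sub_mem_Icc hq.1.1), qubitEntropy_four_mul,
    qubitEntropy_qubitEntropyInv (snd_mem_Icc_of_mem_qubitEntropyRegion hq)]
  exact hq.1.2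

theorem convex_qubitEntropyRegion : Convex ℝ qubitEntropyRegion :=
  strictConcave_binEntropy.concaveOn.convex_hypograph.inter
    (convexOn_const 0 (convex_Icc 0 1)).convex_epigraph

theorem convex_strictQubitEntropyRegion : Convex ℝ strictQubitEntropyRegion :=
  strictConcave_binEntropy.concaveOn.convex_strict_hypograph.inter
    (convexOn_const 0 (convex_Icc 0 1)).convex_strict_epigraph

theorem strictQubitEntropyRegion_subset : strictQubitEntropyRegion ⊆ qubitEntropyRegion :=
  fun _ hq => ⟨⟨hq.1.1, hq.1.2.le⟩, hq.2.1, hq.2.2.le⟩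

theorem qubitEntropyRegion_subset_closure :
    qubitEntropyRegion ⊆ closure strictQubitEntropyRegion := by
  intro q hq
  have hlog : 0 < log 2 := log_pos one_lt_two
  have hhalf : (2⁻¹ : ℝ) ∈ Set.Icc 0 1 := by norm_num
  have hsubset : openSegment ℝ ((2⁻¹, log 2 / 2) : ℝ × ℝ) q ⊆ strictQubitEntropyRegion :=
    Set.subset_inter
      (strictConcave_binEntropy.concaveOn.openSegment_subset_strict_hypograph _ _
        ⟨hhalf, by rw [binEntropy_two_inv]; exact half_lt_self hlog⟩ hq.1)
      ((convexOn_const 0 (convex_Icc 0 1)).openSegment_subset_strict_epigraph _ _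
        ⟨hhalf, half_pos hlog⟩ hq.2)
  exact closure_mono hsubset (segment_subset_closure_openSegment (right_mem_segment ℝ _ _))

theorem mul_qubitEntropyRatio_add_le {s P y : ℝ} (hs : s ∈ Set.Ioc 0 1) (hy : y ∈ Set.Ioo 0 1)
    (hP : (1 - 2 * P) ^ 2 ≤ 1 - y) (hlt : (dampPair s (P, y)).2 < 1) :
    s * qubitEntropyRatio y + 8 * s * (1 - s) * P ^ 2 ≤
      qubitEntropyRatio (dampPair s (P, y)).2 := by
  obtain ⟨hs0, hs1⟩ := hs
  simp only [dampPair] at hlt ⊢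
  have hr := sqrt_one_sub_mem_Ioo hy
  have hs1' := sub_nonneg.2 hs1
  have hPr : 1 - √(1 - y) ≤ 2 * P := by linarith [abs_le.1 (abs_le_sqrt hP)]
  have hsq : (1 - √(1 - y)) ^ 2 ≤ (2 * P) ^ 2 := pow_le_pow_left₀ (sub_pos.2 hr.2).le hPr 2
  have hle : √(1 - (s * y + 4 * s * (1 - s) * P ^ 2)) ≤ 1 - s * (1 - √(1 - y)) := by
    refine sqrt_le_iff.2 ⟨by nlinarith [hr.1, hr.2], ?_⟩
    nlinarith [mul_le_mul_of_nonneg_left hsq (mul_nonneg hs0.le hs1'),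
      sq_sqrt (sub_pos.2 hy.2).le]
  have hcurv := mul_entropyCurvature_le hr ⟨hs0, hs1⟩ (sqrt_pos.2 (sub_pos.2 hlt)) hle
  simp only [qubitEntropyRatio]
  linarith

theorem sq_add_div_le {s D P e θ θ' : ℝ} (hs : s ∈ Set.Ioc 0 1) (hθ : 0 < θ)
    (hθ' : s * θ + 8 * s * (1 - s) * P ^ 2 ≤ θ') :
    (s * D + 8 * s * (1 - s) * P * e) ^ 2 / θ' ≤ s * (D ^ 2 / θ) + 8 * s * (1 - s) * e ^ 2 := by
  obtain ⟨hs0, hs1⟩ := hs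
  have := sub_nonneg.2 hs1
  have hpos : 0 < s * θ + 8 * s * (1 - s) * P ^ 2 := by positivity
  have hcauchy : (s * D + 8 * s * (1 - s) * P * e) ^ 2 ≤
      (s * (D ^ 2 / θ) + 8 * s * (1 - s) * e ^ 2) * (s * θ + 8 * s * (1 - s) * P ^ 2) := by
    have : 0 ≤ 8 * s ^ 2 * (1 - s) * (D * P - θ * e) ^ 2 / θ := by positivity
    refine sub_nonneg.1 (this.trans_eq ?_)
    field_simp
    ring
  rw [div_le_iff₀ (hpos.trans_le hθ')]
  exact hcauchy.trans (by gcongr)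

theorem snd_mem_Ioo_of_mem_strictQubitEntropyRegion (hq : q ∈ strictQubitEntropyRegion) :
    q.2 ∈ Set.Ioo 0 (log 2) :=
  ⟨hq.2.2, hq.1.2.trans_le binEntropy_le_log_two⟩

theorem dampPair_snd_mem_Ioo (hs : s ∈ Set.Ioc 0 1) (hq : q ∈ strictQubitEntropyRegion) :
    (dampPair s (q.1, qubitEntropyInv q.2)).2 ∈ Set.Ioo 0 1 := by
  have hy := qubitEntropyInv_mem_Ioo (snd_mem_Ioo_of_mem_strictQubitEntropyRegion hq)
  have hlt : qubitEntropyInv q.2 < 4 * q.1 * (1 - q.1) := by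
    rw [← strictMonoOn_qubitEntropy.lt_iff_lt (Set.Ioo_subset_Icc_self hy)
      (four_mul_mul_one_sub_mem_Icc hq.1.1), qubitEntropy_four_mul, qubitEntropy_qubitEntropyInv
      (Set.Ioo_subset_Icc_self (snd_mem_Ioo_of_mem_strictQubitEntropyRegion hq))]
    exact hq.1.2
  have hs1 := sub_nonneg.2 hs.2
  refine ⟨add_pos_of_pos_of_nonneg (mul_pos hs.1 hy.1) ?_, ?_⟩
  · have := hs.1
    positivity
  · simp only [dampPair]
    nlinarith [sq_nonneg (1 - 2 * s * q.1), mul_lt_mul_of_pos_left hlt hs.1]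

theorem mul_qubitEntropyRatio_qubitEntropyInv_add_le (hs : s ∈ Set.Ioc 0 1)
    (hq : q ∈ strictQubitEntropyRegion) :
    s * qubitEntropyRatio (qubitEntropyInv q.2) + 8 * s * (1 - s) * q.1 ^ 2 ≤
      qubitEntropyRatio (dampPair s (q.1, qubitEntropyInv q.2)).2 := by
  have hregion := (mem_qubitRegion_of_mem_qubitEntropyRegion (strictQubitEntropyRegion_subset hq)).2
  exact mul_qubitEntropyRatio_add_le hs
    (qubitEntropyInv_mem_Ioo (snd_mem_Ioo_of_mem_strictQubitEntropyRegion hq))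
    (by linarith [hregion.2]) (dampPair_snd_mem_Ioo hs hq).2

theorem convexOn_qubitEntropy_dampPair {I : Set ℝ} {P y y' : ℝ → ℝ} {e : ℝ} (hs : s ∈ Set.Ioc 0 1)
    (hI : Convex ℝ I) (hP : ∀ t, HasDerivAt P e t) (hy : ∀ t ∈ I, HasDerivAt y (y' t) t)
    (hy' : ∀ t ∈ I, HasDerivAt y' (y' t ^ 2 / qubitEntropyRatio (y t)) t)
    (hmem : ∀ t ∈ I, y t ∈ Set.Ioo 0 1)
    (hdamp : ∀ t ∈ I, (dampPair s (P t, y t)).2 ∈ Set.Ioo 0 1)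
    (hratio : ∀ t ∈ I, s * qubitEntropyRatio (y t) + 8 * s * (1 - s) * P t ^ 2 ≤
      qubitEntropyRatio (dampPair s (P t, y t)).2) :
    ConvexOn ℝ I fun t => qubitEntropy (dampPair s (P t, y t)).2 := by
  have hz : ∀ t ∈ I, HasDerivAt (fun t => (dampPair s (P t, y t)).2)
      (s * y' t + 8 * s * (1 - s) * P t * e) t := fun t ht => by
    refine (((hy t ht).const_mul s).add
      (((hP t).pow 2).const_mul (4 * s * (1 - s)))).congr_deriv ?_
    ring
  have hz' : ∀ t ∈ I, HasDerivAt (fun t => s * y' t + 8 * s * (1 - s) * P t * e)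
      (s * (y' t ^ 2 / qubitEntropyRatio (y t)) + 8 * s * (1 - s) * e ^ 2) t := fun t ht => by
    refine (((hy' t ht).const_mul s).add
      (((hP t).const_mul (8 * s * (1 - s))).mul_const e)).congr_deriv ?_
    ring
  exact convexOn_qubitEntropy_comp hI hdamp hz hz' fun t ht =>
    sq_add_div_le hs (qubitEntropyRatio_pos (hmem t ht)) (hratio t ht)

theorem convexOn_dampedEntropy_comp {I : Set ℝ} {P v : ℝ → ℝ} {e d : ℝ} (hs : s ∈ Set.Ioc 0 1)
    (hI : Convex ℝ I) (hP : ∀ t, HasDerivAt P e t) (hv : ∀ t, HasDerivAt v d t)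
    (hmem : ∀ t ∈ I, (P t, v t) ∈ strictQubitEntropyRegion) :
    ConvexOn ℝ I fun t => dampedEntropy s (P t, v t) := by
  have hv_mem (t : ℝ) (ht : t ∈ I) := snd_mem_Ioo_of_mem_strictQubitEntropyRegion (hmem t ht)
  refine convexOn_qubitEntropy_dampPair hs hI hP
    (y' := fun t => (qubitEntropyDeriv (qubitEntropyInv (v t)))⁻¹ * d)
    (fun t ht => (hasDerivAt_qubitEntropyInv (hv_mem t ht)).comp t (hv t)) (fun t ht => ?_)
    (fun t ht => qubitEntropyInv_mem_Ioo (hv_mem t ht))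
    (fun t ht => dampPair_snd_mem_Ioo hs (hmem t ht))
    fun t ht => mul_qubitEntropyRatio_qubitEntropyInv_add_le hs (hmem t ht)
  have hderiv := (hasDerivAt_inv_qubitEntropyDeriv_qubitEntropyInv (hv_mem t ht)).comp t (hv t)
  refine (hderiv.mul_const d).congr_deriv ?_
  ring

theorem continuous_dampedEntropy (s : ℝ) : Continuous (dampedEntropy s) := by
  have := continuous_qubitEntropyInv
  exact continuous_qubitEntropy.comp (by unfold dampPair; fun_prop)

theorem convexOn_dampedEntropy (hs : s ∈ Set.Ioc 0 1) :
    ConvexOn ℝ qubitEntropyRegion (dampedEntropy s) := by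
  have hstrict : ConvexOn ℝ strictQubitEntropyRegion (dampedEntropy s) :=
    convexOn_of_comp_lineMap convex_strictQubitEntropyRegion fun q₀ h₀ q₁ h₁ => by
      have hline (t : ℝ) : AffineMap.lineMap q₀ q₁ t =
          (AffineMap.lineMap q₀.1 q₁.1 t, AffineMap.lineMap q₀.2 q₁.2 t) := by
        ext <;> simp
      simp only [hline]
      exact convexOn_dampedEntropy_comp hs (convex_Icc 0 1)
        (fun _ => AffineMap.hasDerivAt_lineMap) (fun _ => AffineMap.hasDerivAt_lineMap)
        fun t ht => hline t ▸ convex_strictQubitEntropyRegion.lineMap_mem h₀ h₁ ht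
  exact (convexOn_closure hstrict (continuous_dampedEntropy s)).subset
    qubitEntropyRegion_subset_closure convex_qubitEntropyRegion

end Damping

section Averages

open Real

variable {ι : Type*} [Fintype ι] {w : ι → ℝ} {q : ι → ℝ × ℝ}

/-- The average entropy, in nats, of the outputs of the amplitude damping channel with
transmissivity `z` on qubit states with weights `w` and pairs `q`. -/
noncomputable def meanDampedEntropy (w : ι → ℝ) (q : ι → ℝ × ℝ) (z : ℝ) : ℝ :=
  ∑ i, w i * qubitEntropy (dampPair z (q i)).2

theorem sum_smul_dampPair_qubitEntropy (w : ι → ℝ) (q : ι → ℝ × ℝ) (z : ℝ) :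
    ∑ i, w i • ((dampPair z (q i)).1, qubitEntropy (dampPair z (q i)).2) =
      (z * ∑ i, w i * (q i).1, meanDampedEntropy w q z) := by
  ext
  · simp [dampPair, Prod.fst_sum, Finset.mul_sum, mul_left_comm]
  · simp [meanDampedEntropy, Prod.snd_sum]

theorem mean_mem_qubitEntropyRegion {z : ℝ} (hw : ∀ i, 0 ≤ w i) (hw1 : ∑ i, w i = 1)
    (hq : ∀ i, q i ∈ qubitRegion) (hz : z ∈ Set.Icc 0 1) :
    (z * ∑ i, w i * (q i).1, meanDampedEntropy w q z) ∈ qubitEntropyRegion := by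
  rw [← sum_smul_dampPair_qubitEntropy]
  exact convex_qubitEntropyRegion.sum_mem (fun i _ => hw i) hw1 fun i _ =>
    mem_qubitEntropyRegion_of_mem_qubitRegion (dampPair_mem_qubitRegion hz (hq i))

theorem dampedEntropy_mean_le {s z : ℝ} (hw : ∀ i, 0 ≤ w i) (hw1 : ∑ i, w i = 1)
    (hq : ∀ i, q i ∈ qubitRegion) (hs : s ∈ Set.Ioc 0 1) (hz : z ∈ Set.Icc 0 1) :
    dampedEntropy s (z * ∑ i, w i * (q i).1, meanDampedEntropy w q z) ≤
      meanDampedEntropy w q (s * z) := by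
  have hdamp (i : ι) := dampPair_mem_qubitRegion hz (hq i)
  have hjensen := (convexOn_dampedEntropy hs).map_sum_le (t := Finset.univ) (fun i _ => hw i) hw1
    fun i _ => mem_qubitEntropyRegion_of_mem_qubitRegion (hdamp i)
  rw [sum_smul_dampPair_qubitEntropy] at hjensen
  refine hjensen.trans_eq (Finset.sum_congr rfl fun i _ => ?_)
  rw [dampedEntropy, qubitEntropyInv_qubitEntropy (snd_mem_Icc_of_mem_qubitRegion (hdamp i)),
    dampPair_dampPair, smul_eq_mul]

/-- Four times the determinant of a qubit state whose entropy after damping with transmissivity `z`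
is the average `meanDampedEntropy w q z`. -/
noncomputable def meanDampedDet (w : ι → ℝ) (q : ι → ℝ × ℝ) (z : ℝ) : ℝ :=
  qubitEntropyInv (meanDampedEntropy w q z)

theorem dampPair_meanDampedDet_le {s z : ℝ} (hw : ∀ i, 0 ≤ w i) (hw1 : ∑ i, w i = 1)
    (hq : ∀ i, q i ∈ qubitRegion) (hs : s ∈ Set.Ioc 0 1) (hz : z ∈ Set.Icc 0 1) :
    (dampPair s (z * ∑ i, w i * (q i).1, meanDampedDet w q z)).2 ≤ meanDampedDet w q (s * z) := by
  have hmem {z : ℝ} (hz : z ∈ Set.Icc 0 1) := mean_mem_qubitEntropyRegion hw hw1 hq hz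
  rw [meanDampedDet, meanDampedDet, ← qubitEntropy_le_iff_le_qubitEntropyInv]
  · exact dampedEntropy_mean_le hw hw1 hq hs hz
  · exact snd_mem_Icc_of_mem_qubitRegion (dampPair_mem_qubitRegion (Set.Ioc_subset_Icc_self hs)
      (mem_qubitRegion_of_mem_qubitEntropyRegion (hmem hz)))
  · exact snd_mem_Icc_of_mem_qubitEntropyRegion
      (hmem (z := s * z) ⟨mul_nonneg hs.1.le hz.1, mul_le_one₀ hs.2 hz.1 hz.2⟩)

theorem dampPair_snd_le_iff {s P y y' : ℝ} (hs : 0 < s) :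
    (dampPair s (P, y)).2 ≤ (dampPair s (P, y')).2 ↔ y ≤ y' := by
  simp [dampPair, hs]

theorem dampPair_diagonal (z P : ℝ) :
    (dampPair z (P, 4 * P * (1 - P))).2 = 4 * (z * P) * (1 - z * P) := by
  simp only [dampPair]
  ring

theorem qubitEntropy_dampPair_diagonal (z P : ℝ) :
    qubitEntropy (dampPair z (P, 4 * P * (1 - P))).2 = binEntropy (z * P) := by
  rw [dampPair_diagonal, qubitEntropy_four_mul]

theorem exists_dampPair_eq_meanDampedDet {t : ℝ} (hw : ∀ i, 0 ≤ w i) (hw1 : ∑ i, w i = 1)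
    (hq : ∀ i, q i ∈ qubitRegion) (ht : t ∈ Set.Ioc 0 1) :
    ∃ y, (∑ i, w i * (q i).1, y) ∈ qubitRegion ∧
      (dampPair t (∑ i, w i * (q i).1, y)).2 = meanDampedDet w q t ∧
      ∀ z ∈ Set.Icc t 1, meanDampedDet w q z ≤ (dampPair z (∑ i, w i * (q i).1, y)).2 := by
  set P := ∑ i, w i * (q i).1 with hP
  have hmem {z : ℝ} (hz : z ∈ Set.Icc 0 1) : (z * P, meanDampedDet w q z) ∈ qubitRegion :=
    mem_qubitRegion_of_mem_qubitEntropyRegion (mean_mem_qubitEntropyRegion hw hw1 hq hz)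
  have hone : (1 : ℝ) ∈ Set.Icc t 1 := ⟨ht.2, le_rfl⟩
  obtain ⟨y, hy⟩ : ∃ y, (dampPair t (P, y)).2 = meanDampedDet w q t :=
    ⟨(meanDampedDet w q t - 4 * t * (1 - t) * P ^ 2) / t, by
      simp only [dampPair]
      rw [mul_div_cancel₀ _ ht.1.ne', sub_add_cancel]⟩
  have hle : ∀ z ∈ Set.Icc t 1, meanDampedDet w q z ≤ (dampPair z (P, y)).2 := fun z hz => by
    have hz0 : 0 < z := ht.1.trans_le hz.1
    have hscale : t / z * z = t := div_mul_cancel₀ t hz0.ne'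
    have hdamp := dampPair_meanDampedDet_le hw hw1 hq
      ⟨div_pos ht.1 hz0, (div_le_one hz0).2 hz.1⟩ ⟨hz0.le, hz.2⟩
    rw [hscale, ← hy, ← hP] at hdamp
    rw [← dampPair_snd_le_iff (P := z * P) (div_pos ht.1 hz0)]
    refine hdamp.trans_eq ?_
    rw [← hscale, ← dampPair_dampPair, hscale]
    rfl
  refine ⟨y, ⟨by simpa using (hmem ⟨zero_le_one, le_rfl⟩).1, ?_, ?_⟩, hy, hle⟩
  · have := hle 1 hone
    rw [dampPair_one] at this
    exact (qubitEntropyInv_mem_Icc _).1.trans this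
  · rw [← dampPair_snd_le_iff ht.1, hy, dampPair_diagonal]
    exact (hmem ⟨ht.1.le, ht.2⟩).2.2

theorem exists_qubitEntropy_dampPair_eq_mean {t : ℝ} (hw : ∀ i, 0 ≤ w i) (hw1 : ∑ i, w i = 1)
    (hq : ∀ i, q i ∈ qubitRegion) (ht : t ∈ Set.Icc 0 1) :
    ∃ y, (∑ i, w i * (q i).1, y) ∈ qubitRegion ∧
      qubitEntropy (dampPair t (∑ i, w i * (q i).1, y)).2 = meanDampedEntropy w q t ∧
      ∀ z ∈ Set.Icc t 1, meanDampedEntropy w q z ≤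
        qubitEntropy (dampPair z (∑ i, w i * (q i).1, y)).2 := by
  have hmem {z : ℝ} (hz : z ∈ Set.Icc 0 1) := mean_mem_qubitEntropyRegion hw hw1 hq hz
  have hinv {z : ℝ} (hz : z ∈ Set.Icc 0 1) :
      qubitEntropy (meanDampedDet w q z) = meanDampedEntropy w q z :=
    qubitEntropy_qubitEntropyInv (snd_mem_Icc_of_mem_qubitEntropyRegion (hmem hz))
  rcases ht.1.eq_or_lt with rfl | ht0
  · have hP := (hmem (z := 1) ⟨zero_le_one, le_rfl⟩).1.1
    simp only [one_mul] at hP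
    refine ⟨_, ⟨hP, (four_mul_mul_one_sub_mem_Icc hP).1, le_rfl⟩, ?_, fun z hz => ?_⟩
    · simp [dampPair, meanDampedEntropy, qubitEntropy_zero]
    · rw [qubitEntropy_dampPair_diagonal]
      exact (hmem hz).1.2
  · obtain ⟨y, hy, heq, hle⟩ := exists_dampPair_eq_meanDampedDet hw hw1 hq ⟨ht0, ht.2⟩
    refine ⟨y, hy, by rw [heq, hinv ht], fun z hz => ?_⟩
    have hz01 : z ∈ Set.Icc 0 1 := ⟨ht.1.trans hz.1, hz.2⟩
    rw [← hinv hz01]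
    exact monotoneOn_qubitEntropy (qubitEntropyInv_mem_Icc _)
      (snd_mem_Icc_of_mem_qubitRegion (dampPair_mem_qubitRegion hz01 hy)) (hle z hz)

end Averages

section Entropy

open Polynomial

variable {ι m n : Type} [Fintype ι] [Fintype m] [Fintype n]

theorem vonNeumannEntropy_eq_sum_roots [DecidableEq m] {ρ : Matrix m m ℂ} (hρ : ρ.IsHermitian) :
    vonNeumannEntropy ρ =
      (ρ.charpoly.roots.map fun z => Real.negMulLog z.re).sum / Real.log 2 := by
  obtain rfl : ‹DecidableEq m› = fun i j => Classical.propDecidable (i = j) :=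
    Subsingleton.elim _ _
  classical
  rw [vonNeumannEntropy, dif_pos hρ, hρ.roots_charpoly_eq_eigenvalues, Multiset.map_map,
    Finset.sum_map_val, Finset.sum_div, ← Finset.sum_neg_distrib]
  refine Finset.sum_congr rfl fun i _ => ?_
  simp only [Function.comp, Complex.coe_algebraMap, Complex.ofReal_re, Real.negMulLog, Real.logb]
  ring

theorem vonNeumannEntropy_eq_of_charpoly [DecidableEq m] {ρ : Matrix m m ℂ} (hρ : ρ.IsHermitian)
    {d : ι → ℝ} (h : ρ.charpoly = ∏ i, (X - C (d i : ℂ))) :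
    vonNeumannEntropy ρ = (∑ i, Real.negMulLog (d i)) / Real.log 2 := by
  rw [vonNeumannEntropy_eq_sum_roots hρ, h,
    roots_prod _ _ (Finset.prod_ne_zero_iff.2 fun i _ => X_sub_C_ne_zero _)]
  simp

theorem vonNeumannEntropy_transpose {ρ : Matrix m m ℂ} (hρ : ρ.IsHermitian) :
    vonNeumannEntropy ρᵀ = vonNeumannEntropy ρ := by
  classical
  rw [vonNeumannEntropy_eq_sum_roots hρ, vonNeumannEntropy_eq_sum_roots hρ.transpose,
    Matrix.charpoly_transpose]

theorem vonNeumannEntropy_reindex {ρ : Matrix m m ℂ} (hρ : ρ.IsHermitian) (f : m ≃ n) :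
    vonNeumannEntropy (Matrix.reindex f f ρ) = vonNeumannEntropy ρ := by
  classical
  have hreindex : (Matrix.reindex f f ρ).IsHermitian := hρ.submatrix _
  rw [vonNeumannEntropy_eq_sum_roots hρ, vonNeumannEntropy_eq_sum_roots hreindex,
    Matrix.charpoly_reindex]

theorem vonNeumannEntropy_mul_conjTranspose_self (W : Matrix m n ℂ) :
    vonNeumannEntropy (W * Wᴴ) = vonNeumannEntropy (Wᴴ * W) := by
  classical
  have hroots := congrArg roots (Matrix.charpoly_mul_comm' W Wᴴ)
  have hne {k : ℕ} {l : Type} [Fintype l] (A : Matrix l l ℂ) : X ^ k * A.charpoly ≠ 0 :=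
    mul_ne_zero (pow_ne_zero _ X_ne_zero) A.charpoly_monic.ne_zero
  rw [roots_mul (hne _), roots_mul (hne _)] at hroots
  have hsum := congrArg (fun s => (s.map fun z : ℂ => Real.negMulLog z.re).sum) hroots
  rw [vonNeumannEntropy_eq_sum_roots (Matrix.isHermitian_mul_conjTranspose_self W),
    vonNeumannEntropy_eq_sum_roots (Matrix.isHermitian_conjTranspose_mul_self W)]
  congr 1
  simpa [Multiset.map_nsmul, Multiset.sum_nsmul] using hsum

theorem vonNeumannEntropy_transpose_mul_conjTranspose_self (W : Matrix m n ℂ) :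
    vonNeumannEntropy (Wᵀ * Wᵀᴴ) = vonNeumannEntropy (W * Wᴴ) := by
  rw [vonNeumannEntropy_mul_conjTranspose_self,
    ← vonNeumannEntropy_transpose (Matrix.isHermitian_mul_conjTranspose_self W),
    Matrix.transpose_mul]
  rfl

/-- The Shannon entropy, in bits, of the weights `p`. -/
noncomputable def shannonEntropy (p : ι → ℝ) : ℝ := (∑ i, Real.negMulLog (p i)) / Real.log 2

theorem vonNeumannEntropy_diagonal [DecidableEq ι] (p : ι → ℝ) :
    vonNeumannEntropy (Matrix.diagonal fun i => (p i : ℂ)) = shannonEntropy p :=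
  vonNeumannEntropy_eq_of_charpoly
    (Matrix.isHermitian_diagonal_of_self_adjoint _ (by ext; simp)) (Matrix.charpoly_diagonal _)

theorem charpoly_blockDiagonal {R o l : Type*} [CommRing R] [Fintype o] [DecidableEq o]
    [Fintype l] [DecidableEq l] (M : o → Matrix l l R) :
    (Matrix.blockDiagonal M).charpoly = ∏ k, (M k).charpoly := by
  have hchar : (Matrix.blockDiagonal M).charmatrix =
      Matrix.blockDiagonal fun k => (M k).charmatrix := by
    ext1 ⟨i, k⟩ ⟨j, l⟩
    simp only [Matrix.charmatrix_apply, Matrix.blockDiagonal_apply, Matrix.diagonal_apply,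
      Prod.mk.injEq]
    by_cases hkl : k = l <;> simp [hkl]
  rw [Matrix.charpoly, hchar, Matrix.det_blockDiagonal]
  rfl

theorem charpoly_real_smul [DecidableEq m] {σ : Matrix m m ℂ} (hσ : σ.IsHermitian) (p : ℝ) :
    ((p : ℂ) • σ).charpoly = ∏ i, (X - C ((p * hσ.eigenvalues i : ℝ) : ℂ)) := by
  conv_lhs => rw [hσ.spectral_theorem, ← map_smul, Unitary.conjStarAlgAut_apply,
    Matrix.charpoly_mul_comm, ← mul_assoc]
  simp [← Matrix.diagonal_smul, Matrix.charpoly_diagonal]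

/-- The classical-quantum state `∑ᵢ pᵢ |i⟩⟨i| ⊗ σᵢ`. -/
def cqMatrix [DecidableEq ι] (p : ι → ℝ) (σ : ι → Matrix m m ℂ) : Matrix (ι × m) (ι × m) ℂ :=
  Matrix.reindex (Equiv.prodComm m ι) (Equiv.prodComm m ι)
    (Matrix.blockDiagonal fun i => (p i : ℂ) • σ i)

theorem cqMatrix_apply {ι m : Type} [DecidableEq ι] (p : ι → ℝ) (σ : ι → Matrix m m ℂ)
    (s t : ι × m) :
    cqMatrix p σ s t = if s.1 = t.1 then (p s.1 : ℂ) * σ s.1 s.2 t.2 else 0 := by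
  simp [cqMatrix, Matrix.blockDiagonal_apply]

theorem isHermitian_blockDiagonal_real_smul {o l : Type*} [DecidableEq o] (p : o → ℝ)
    {σ : o → Matrix l l ℂ} (hσ : ∀ i, (σ i).IsHermitian) :
    (Matrix.blockDiagonal fun i => (p i : ℂ) • σ i).IsHermitian := by
  rw [Matrix.IsHermitian, Matrix.blockDiagonal_conjTranspose]
  simp [Matrix.conjTranspose_smul, (hσ _).eq]

theorem sum_eigenvalues_eq_one [DecidableEq m] {σ : Matrix m m ℂ} (hσ : σ.IsHermitian)
    (htr : σ.trace = 1) : ∑ i, hσ.eigenvalues i = 1 := by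
  rw [hσ.trace_eq_sum_eigenvalues] at htr
  apply Complex.ofReal_injective
  simpa using htr

theorem vonNeumannEntropy_cqMatrix [DecidableEq ι] (p : ι → ℝ) {σ : ι → Matrix m m ℂ}
    (hσ : ∀ i, (σ i).IsHermitian) (htr : ∀ i, (σ i).trace = 1) :
    vonNeumannEntropy (cqMatrix p σ) =
      shannonEntropy p + ∑ i, p i * vonNeumannEntropy (σ i) := by
  classical
  have hchar : (Matrix.blockDiagonal fun i => (p i : ℂ) • σ i).charpoly =
      ∏ s : ι × m, (X - C ((p s.1 * (hσ s.1).eigenvalues s.2 : ℝ) : ℂ)) := by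
    rw [charpoly_blockDiagonal, Fintype.prod_prod_type]
    exact Finset.prod_congr rfl fun i _ => charpoly_real_smul (hσ i) (p i)
  have hherm := isHermitian_blockDiagonal_real_smul p hσ
  rw [cqMatrix, vonNeumannEntropy_reindex hherm, vonNeumannEntropy_eq_of_charpoly hherm hchar,
    Fintype.sum_prod_type, shannonEntropy, Finset.sum_div, Finset.sum_div,
    ← Finset.sum_add_distrib]
  refine Finset.sum_congr rfl fun i _ => ?_
  rw [vonNeumannEntropy_eq_of_charpoly (d := (hσ i).eigenvalues) (hσ i) (hσ i).charpoly_eq]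
  simp_rw [Real.negMulLog_mul]
  rw [Finset.sum_add_distrib, ← Finset.sum_mul, sum_eigenvalues_eq_one (hσ i) (htr i),
    ← Finset.mul_sum]
  ring

end Entropy

section Density

open scoped ComplexOrder

variable {α β κ ι : Type} [Fintype α] [Fintype κ] [Fintype ι]

/-- A density matrix: a positive semidefinite matrix of trace one. -/
structure IsDensityMatrix (ρ : Matrix α α ℂ) : Prop where
  posSemidef : ρ.PosSemidef
  trace_eq_one : ρ.trace = 1

theorem IsDensityMatrix.sum_smul {p : ι → ℝ} {ρ : ι → Matrix α α ℂ} (hp : ∀ i, 0 ≤ p i)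
    (hp1 : ∑ i, p i = 1) (hρ : ∀ i, IsDensityMatrix (ρ i)) :
    IsDensityMatrix (∑ i, (p i : ℂ) • ρ i) where
  posSemidef := Matrix.posSemidef_sum _ fun i _ =>
    (hρ i).posSemidef.smul (Complex.zero_le_real.2 (hp i))
  trace_eq_one := by
    simp only [Matrix.trace_sum, Matrix.trace_smul, (hρ _).trace_eq_one, smul_eq_mul, mul_one]
    exact_mod_cast hp1

theorem krausMap_apply (K : κ → Matrix β α ℂ) (ρ : Matrix α α ℂ) :
    krausMap K ρ = ∑ k, K k * ρ * (K k)ᴴ := rfl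

theorem trace_krausMap [Fintype β] [DecidableEq α] {K : κ → Matrix β α ℂ}
    (hK : ∑ k, (K k)ᴴ * K k = 1) (ρ : Matrix α α ℂ) : (krausMap K ρ).trace = ρ.trace := by
  simp only [krausMap_apply, Matrix.trace_sum, Matrix.trace_mul_cycle _ ρ]
  rw [← Matrix.trace_sum, ← Matrix.sum_mul, hK, one_mul]

theorem IsDensityMatrix.krausMap [Fintype β] [DecidableEq α] {K : κ → Matrix β α ℂ}
    {ρ : Matrix α α ℂ} (hρ : IsDensityMatrix ρ) (hK : ∑ k, (K k)ᴴ * K k = 1) :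
    IsDensityMatrix (krausMap K ρ) where
  posSemidef := Matrix.posSemidef_sum _ fun k _ => hρ.posSemidef.mul_mul_conjTranspose_same (K k)
  trace_eq_one := (trace_krausMap hK ρ).trans hρ.trace_eq_one

/-- The Kraus operators of the complementary channel, which sends the input of the isometric
extension `∑ₖ Kₖ ⊗ |k⟩` of the channel to its environment. -/
def complementaryKraus (K : κ → Matrix β α ℂ) : β → Matrix κ α ℂ :=
  fun b => Matrix.of fun k i => K k b i

end Density

section Marginals

variable {X A B : Type} [DecidableEq X]

theorem margAX_cqMatrix [Fintype B] (p : X → ℝ)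
    (σ : X → Matrix (A × B) (A × B) ℂ) :
    margAX (cqMatrix p σ) =
      cqMatrix p fun x => Matrix.of fun a a' => ∑ b, σ x (a, b) (a', b) := by
  ext ⟨x, a⟩ ⟨x', a'⟩
  by_cases h : x = x' <;> simp [margAX, cqMatrix_apply, h, Finset.mul_sum]

theorem margBX_cqMatrix [Fintype A] (p : X → ℝ)
    (σ : X → Matrix (A × B) (A × B) ℂ) :
    margBX (cqMatrix p σ) =
      cqMatrix p fun x => Matrix.of fun b b' => ∑ a, σ x (a, b) (a, b') := by
  ext ⟨x, b⟩ ⟨x', b'⟩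
  by_cases h : x = x' <;> simp [margBX, cqMatrix_apply, h, Finset.mul_sum]

theorem margB_cqMatrix [Fintype X] [Fintype A] (p : X → ℝ)
    (σ : X → Matrix (A × B) (A × B) ℂ) :
    margB (cqMatrix p σ) =
      ∑ x, (p x : ℂ) • Matrix.of fun b b' => ∑ a, σ x (a, b) (a, b') := by
  ext b b'
  simp [margB, cqMatrix_apply, Finset.mul_sum, Matrix.sum_apply]

theorem margX_cqMatrix [Fintype A] [Fintype B] (p : X → ℝ)
    {σ : X → Matrix (A × B) (A × B) ℂ}
    (hσ : ∀ x, (σ x).trace = 1) :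
    margX (cqMatrix p σ) = Matrix.diagonal fun x => (p x : ℂ) := by
  ext x x'
  by_cases h : x = x'
  · have htr := hσ x'
    simp only [Matrix.trace, Matrix.diag_apply, Fintype.sum_prod_type] at htr
    simp [margX, cqMatrix_apply, ← Finset.mul_sum, htr, h]
  · simp [margX, cqMatrix_apply, h]

end Marginals

namespace PureEnsemble

open scoped ComplexOrder

variable {X A α β κ : Type} [Fintype X] [Fintype A] [Fintype α]
  (e : PureEnsemble X A α)

theorem cqState_eq_cqMatrix [DecidableEq X] (N : Matrix α α ℂ →ₗ[ℂ] Matrix β β ℂ) :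
    e.cqState N = cqMatrix e.prob fun x => idTensor N (e.proj x) := by
  ext ⟨x, s⟩ ⟨x', t⟩
  by_cases h : x = x'
  · simp [cqState, cqMatrix_apply, Matrix.sum_apply, Matrix.single_apply, h]
  · have hne (y : X) : ¬(y = x ∧ y = x') := fun hy => h (hy.1.symm.trans hy.2)
    simp [cqState, cqMatrix_apply, Matrix.sum_apply, h, hne]

/-- The coefficient matrix of the vector `|φˣ⟩`. -/
def coeffMatrix (x : X) : Matrix A α ℂ := Matrix.of fun a i => e.vec x (a, i)

theorem inputState_eq_mul_conjTranspose (x : X) :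
    e.inputState x = (e.coeffMatrix x)ᵀ * (e.coeffMatrix x)ᵀᴴ := rfl

theorem isDensityMatrix_inputState (x : X) : IsDensityMatrix (e.inputState x) where
  posSemidef := Matrix.posSemidef_self_mul_conjTranspose _
  trace_eq_one := by
    have hnorm := congrArg Complex.ofReal (e.vec_norm x)
    rw [Fintype.sum_prod_type_right] at hnorm
    push_cast at hnorm
    rw [← hnorm]
    exact Finset.sum_congr rfl fun i _ => Finset.sum_congr rfl fun a _ => Complex.mul_conj' _

theorem sum_inputSystem_idTensor_proj [Fintype β] {N : Matrix α α ℂ →ₗ[ℂ] Matrix β β ℂ}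
    (hN : ∀ σ, (N σ).trace = σ.trace) (x : X) :
    (Matrix.of fun a a' => ∑ b, idTensor N (e.proj x) (a, b) (a', b)) =
      e.coeffMatrix x * (e.coeffMatrix x)ᴴ := by
  ext a a'
  exact hN (Matrix.of fun i j => e.proj x (a, i) (a', j))

theorem sum_reference_idTensor_proj (N : Matrix α α ℂ →ₗ[ℂ] Matrix β β ℂ) (x : X) :
    (Matrix.of fun b b' => ∑ a, idTensor N (e.proj x) (a, b) (a, b')) = N (e.inputState x) := by
  have hsum : e.inputState x = ∑ a, Matrix.of fun i j => e.proj x (a, i) (a, j) := by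
    ext i j
    simp [inputState, Matrix.sum_apply]
  rw [hsum, map_sum]
  ext b b'
  simp [idTensor, Matrix.sum_apply]

/-- The amplitudes of the isometric extension of the channel with Kraus operators `K` applied to
`|φˣ⟩`, as a matrix from the environment to the reference and the output. -/
def outputMatrix (K : κ → Matrix β α ℂ) (x : X) : Matrix (A × β) κ ℂ :=
  Matrix.of fun s k => (K k *ᵥ e.coeffMatrix x s.1) s.2

theorem idTensor_krausMap_proj [Fintype κ] (K : κ → Matrix β α ℂ) (x : X) :
    idTensor (krausMap K) (e.proj x) = e.outputMatrix K x * (e.outputMatrix K x)ᴴ := by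
  ext ⟨a, b⟩ ⟨a', b'⟩
  have hproj : (Matrix.of fun i j => e.proj x (a, i) (a', j)) =
      Matrix.vecMulVec (e.coeffMatrix x a) (star (e.coeffMatrix x a')) := rfl
  simp only [idTensor, Matrix.of_apply, hproj, krausMap_apply, Matrix.mul_vecMulVec,
    Matrix.vecMulVec_mul, ← Matrix.star_mulVec, Matrix.sum_apply]
  rfl

theorem outputMatrix_transpose_mul_conjTranspose [Fintype β] (K : κ → Matrix β α ℂ) (x : X) :
    (e.outputMatrix K x)ᵀ * (e.outputMatrix K x)ᵀᴴ =
      krausMap (complementaryKraus K) (e.inputState x) := by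
  rw [krausMap_apply, inputState_eq_mul_conjTranspose]
  have hassoc (b : β) : complementaryKraus K b * ((e.coeffMatrix x)ᵀ * (e.coeffMatrix x)ᵀᴴ) *
      (complementaryKraus K b)ᴴ = (complementaryKraus K b * (e.coeffMatrix x)ᵀ) *
        (complementaryKraus K b * (e.coeffMatrix x)ᵀ)ᴴ := by
    simp only [Matrix.conjTranspose_mul, Matrix.mul_assoc]
  ext k k'
  rw [Finset.sum_congr rfl fun b _ => hassoc b, Matrix.mul_apply, Matrix.sum_apply,
    Fintype.sum_prod_type_right]
  rfl

variable [Fintype β] [Fintype κ]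

theorem vonNeumannEntropy_idTensor_proj (K : κ → Matrix β α ℂ) (x : X) :
    vonNeumannEntropy (idTensor (krausMap K) (e.proj x)) =
      vonNeumannEntropy (krausMap (complementaryKraus K) (e.inputState x)) := by
  rw [idTensor_krausMap_proj, ← vonNeumannEntropy_transpose_mul_conjTranspose_self,
    outputMatrix_transpose_mul_conjTranspose]

/-- The average entropy of the images of the input states under `N`. -/
noncomputable def meanEntropy (N : Matrix α α ℂ → Matrix β β ℂ) : ℝ :=
  ∑ x, e.prob x * vonNeumannEntropy (N (e.inputState x))

/-- The average input state. -/
noncomputable def meanInput : Matrix α α ℂ :=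
  ∑ x, (e.prob x : ℂ) • e.inputState x

theorem vonNeumannEntropy_margB (K : κ → Matrix β α ℂ) :
    vonNeumannEntropy (margB (e.cqState (krausMap K))) =
      vonNeumannEntropy (krausMap K e.meanInput) := by
  classical
  simp only [cqState_eq_cqMatrix, margB_cqMatrix, sum_reference_idTensor_proj, meanInput, map_sum,
    map_smul]

variable {K : κ → Matrix β α ℂ} [DecidableEq α] (hK : ∑ k, (K k)ᴴ * K k = 1)

include hK

theorem trace_idTensor_proj (x : X) :
    (idTensor (krausMap K) (e.proj x)).trace = 1 := by
  rw [← (e.isDensityMatrix_inputState x).trace_eq_one, ← trace_krausMap hK,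
    ← sum_reference_idTensor_proj, Matrix.trace, Fintype.sum_prod_type_right]
  rfl

theorem vonNeumannEntropy_margX :
    vonNeumannEntropy (margX (e.cqState (krausMap K))) = shannonEntropy e.prob := by
  classical
  rw [cqState_eq_cqMatrix, margX_cqMatrix _ (e.trace_idTensor_proj hK), vonNeumannEntropy_diagonal]

theorem vonNeumannEntropy_margAX :
    vonNeumannEntropy (margAX (e.cqState (krausMap K))) =
      shannonEntropy e.prob + e.meanEntropy id := by
  classical
  have hA (x : X) : vonNeumannEntropy (e.coeffMatrix x * (e.coeffMatrix x)ᴴ) =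
      vonNeumannEntropy (e.inputState x) := by
    rw [inputState_eq_mul_conjTranspose, vonNeumannEntropy_transpose_mul_conjTranspose_self]
  have htr (x : X) : (e.coeffMatrix x * (e.coeffMatrix x)ᴴ).trace = 1 := by
    rw [← e.sum_inputSystem_idTensor_proj (trace_krausMap hK), ← e.trace_idTensor_proj hK x,
      Matrix.trace, Matrix.trace, Fintype.sum_prod_type]
    rfl
  rw [cqState_eq_cqMatrix, margAX_cqMatrix]
  simp only [e.sum_inputSystem_idTensor_proj (trace_krausMap hK)]
  rw [vonNeumannEntropy_cqMatrix _ (fun x => Matrix.isHermitian_mul_conjTranspose_self _) htr]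
  simp only [hA, meanEntropy, id]

theorem vonNeumannEntropy_margBX :
    vonNeumannEntropy (margBX (e.cqState (krausMap K))) =
      shannonEntropy e.prob + e.meanEntropy (krausMap K) := by
  classical
  have hB (x : X) := (e.isDensityMatrix_inputState x).krausMap hK
  rw [cqState_eq_cqMatrix, margBX_cqMatrix]
  simp only [sum_reference_idTensor_proj]
  exact vonNeumannEntropy_cqMatrix _ (fun x => (hB x).posSemidef.isHermitian)
    fun x => (hB x).trace_eq_one

theorem vonNeumannEntropy_cqState :
    vonNeumannEntropy (e.cqState (krausMap K)) =
      shannonEntropy e.prob + e.meanEntropy (krausMap (complementaryKraus K)) := by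
  classical
  rw [cqState_eq_cqMatrix, vonNeumannEntropy_cqMatrix _ (fun x => ?_) (e.trace_idTensor_proj hK)]
  · simp only [vonNeumannEntropy_idTensor_proj, meanEntropy]
  · rw [idTensor_krausMap_proj]
    exact Matrix.isHermitian_mul_conjTranspose_self _

theorem mutualInfoAXB_cqState :
    mutualInfoAXB (e.cqState (krausMap K)) = vonNeumannEntropy (krausMap K e.meanInput) +
      e.meanEntropy id - e.meanEntropy (krausMap (complementaryKraus K)) := by
  rw [mutualInfoAXB, e.vonNeumannEntropy_margAX hK, vonNeumannEntropy_margB,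
    e.vonNeumannEntropy_cqState hK]
  ring

theorem coherentInfo_cqState :
    coherentInfo (e.cqState (krausMap K)) =
      e.meanEntropy (krausMap K) - e.meanEntropy (krausMap (complementaryKraus K)) := by
  rw [coherentInfo, e.vonNeumannEntropy_margBX hK, e.vonNeumannEntropy_cqState hK]
  ring

theorem holevoInfo_cqState :
    holevoInfo (e.cqState (krausMap K)) =
      vonNeumannEntropy (krausMap K e.meanInput) - e.meanEntropy (krausMap K) := by
  rw [holevoInfo, e.vonNeumannEntropy_margX hK, vonNeumannEntropy_margB,
    e.vonNeumannEntropy_margBX hK]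
  ring

end PureEnsemble

section Qubit

open scoped ComplexOrder

/-- The population of `|0⟩` and four times the determinant of a qubit state. -/
def qubitPair (ρ : Matrix (Fin 2) (Fin 2) ℂ) : ℝ × ℝ := ((ρ 0 0).re, 4 * ρ.det.re)

variable {ρ : Matrix (Fin 2) (Fin 2) ℂ}

theorem re_det_fin_two_of_isHermitian (hρ : ρ.IsHermitian) :
    ρ.det.re = (ρ 0 0).re * (ρ 1 1).re - Complex.normSq (ρ 0 1) := by
  have h10 : ρ 1 0 = conj (ρ 0 1) := (hρ.apply 1 0).symm
  have hdiag : (ρ 0 0).im = 0 := Complex.conj_eq_iff_im.1 (hρ.apply 0 0)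
  rw [Matrix.det_fin_two, h10, Complex.mul_conj, Complex.sub_re, Complex.mul_re, hdiag, zero_mul,
    sub_zero, Complex.ofReal_re]

theorem IsDensityMatrix.re_apply_one_one (hρ : IsDensityMatrix ρ) :
    (ρ 1 1).re = 1 - (ρ 0 0).re := by
  have htr := congrArg Complex.re hρ.trace_eq_one
  rw [Matrix.trace_fin_two, Complex.add_re, Complex.one_re] at htr
  linarith

theorem IsDensityMatrix.qubitPair_mem_qubitRegion (hρ : IsDensityMatrix ρ) :
    qubitPair ρ ∈ qubitRegion := by
  have h00 : 0 ≤ (ρ 0 0).re := (Complex.nonneg_iff.1 (hρ.posSemidef.diag_nonneg (i := 0))).1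
  have h11 : 0 ≤ (ρ 1 1).re := (Complex.nonneg_iff.1 (hρ.posSemidef.diag_nonneg (i := 1))).1
  have hdet : 0 ≤ ρ.det.re := (Complex.nonneg_iff.1 hρ.posSemidef.det_nonneg).1
  rw [hρ.re_apply_one_one] at h11
  refine ⟨⟨h00, sub_nonneg.1 h11⟩, mul_nonneg zero_le_four hdet, ?_⟩
  simp only [qubitPair]
  rw [re_det_fin_two_of_isHermitian hρ.posSemidef.isHermitian, hρ.re_apply_one_one]
  linarith [Complex.normSq_nonneg (ρ 0 1)]

theorem IsDensityMatrix.vonNeumannEntropy_fin_two (hρ : IsDensityMatrix ρ) :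
    vonNeumannEntropy ρ = qubitEntropy (qubitPair ρ).2 / Real.log 2 := by
  set y := (qubitPair ρ).2 with hy
  set r := (1 + √(1 - y)) / 2 with hr
  have hsqrt : √(1 - y) ^ 2 = 1 - y := Real.sq_sqrt <| sub_nonneg.2
    (snd_mem_Icc_of_mem_qubitRegion hρ.qubitPair_mem_qubitRegion).2
  have hdet : ρ.det = ((r * (1 - r) : ℝ) : ℂ) := by
    have hre : ρ.det.re = r * (1 - r) := by
      simp only [qubitPair] at hy
      rw [hr]
      linear_combination (1 / 4 : ℝ) * hsqrt - (1 / 4 : ℝ) * hy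
    rw [← hre]
    exact Complex.ext rfl (Complex.nonneg_iff.1 hρ.posSemidef.det_nonneg).2.symm
  have hcharpoly : ρ.charpoly =
      ∏ i : Fin 2, (Polynomial.X - Polynomial.C ((![r, 1 - r] i : ℝ) : ℂ)) := by
    rw [Matrix.charpoly_fin_two, hρ.trace_eq_one, hdet, Fin.prod_univ_two]
    simp only [Matrix.cons_val_zero, Matrix.cons_val_one, Complex.ofReal_mul, Complex.ofReal_sub,
      Complex.ofReal_one, Polynomial.C_mul, Polynomial.C_sub, Polynomial.C_1]
    ring
  rw [vonNeumannEntropy_eq_of_charpoly hρ.posSemidef.isHermitian hcharpoly, Fin.sum_univ_two,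
    qubitEntropy, Real.binEntropy_eq_negMulLog_add_negMulLog_one_sub]
  rfl

theorem posSemidef_fin_two (hρ : ρ.IsHermitian) (htr : 0 ≤ ρ.trace) (hdet : 0 ≤ ρ.det) :
    ρ.PosSemidef := by
  rw [hρ.trace_eq_sum_eigenvalues, Fin.sum_univ_two, ← RCLike.ofReal_add] at htr
  rw [hρ.det_eq_prod_eigenvalues, Fin.prod_univ_two, ← RCLike.ofReal_mul] at hdet
  have hsum : 0 ≤ hρ.eigenvalues 0 + hρ.eigenvalues 1 := Complex.zero_le_real.1 htr
  have hprod : 0 ≤ hρ.eigenvalues 0 * hρ.eigenvalues 1 := Complex.zero_le_real.1 hdet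
  refine hρ.posSemidef_iff_eigenvalues_nonneg.2 (Fin.forall_fin_two.2 ⟨?_, ?_⟩) <;>
    simp only [Pi.zero_apply] <;> nlinarith

theorem qubitPair_qubitState (p c : ℝ) :
    qubitPair (qubitState p c) = (p, 4 * (p * (1 - p) - c ^ 2)) := by
  have hdet : (qubitState p c).det = ((p * (1 - p) - c ^ 2 : ℝ) : ℂ) := by
    rw [qubitState, Matrix.det_fin_two_of]
    push_cast
    ring
  rw [qubitPair, hdet]
  rfl

theorem isDensityMatrix_qubitState {p c : ℝ} (hc : c ^ 2 ≤ p * (1 - p)) :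
    IsDensityMatrix (qubitState p c) := by
  have htr : (qubitState p c).trace = 1 := by simp [qubitState]
  refine ⟨posSemidef_fin_two ?_ (htr ▸ zero_le_one) ?_, htr⟩
  · ext i j
    fin_cases i <;> fin_cases j <;> simp [qubitState]
  · rw [qubitState, Matrix.det_fin_two_of]
    exact_mod_cast sub_nonneg.2 ((sq c).symm.trans_le hc)

end Qubit

section AmplitudeDamping

open scoped ComplexOrder

variable {s : ℝ} {ρ : Matrix (Fin 2) (Fin 2) ℂ}

theorem sum_conjTranspose_mul_amplitudeDampingKraus (hs : s ∈ Set.Icc 0 1) :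
    ∑ k, (amplitudeDampingKraus s k)ᴴ * amplitudeDampingKraus s k = 1 := by
  have hsqrt : ((√s : ℝ) : ℂ) * (√s : ℝ) + (√(1 - s) : ℝ) * (√(1 - s) : ℝ) = 1 := by
    rw [← Complex.ofReal_mul, ← Complex.ofReal_mul, Real.mul_self_sqrt hs.1,
      Real.mul_self_sqrt (sub_nonneg.2 hs.2), ← Complex.ofReal_add, add_sub_cancel,
      Complex.ofReal_one]
  ext i j
  fin_cases i <;> fin_cases j <;>
    simp [amplitudeDampingKraus, Matrix.mul_apply, Fin.sum_univ_two, Matrix.single_apply, hsqrt]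

theorem amplitudeDamping_apply (hs : s ∈ Set.Icc 0 1) (ρ : Matrix (Fin 2) (Fin 2) ℂ) :
    amplitudeDamping s ρ = !![(s : ℂ) * ρ 0 0, (√s : ℂ) * ρ 0 1;
      (√s : ℂ) * ρ 1 0, ρ 1 1 + ((1 - s : ℝ) : ℂ) * ρ 0 0] := by
  have hsqrt : ((√s : ℝ) : ℂ) * (√s : ℝ) = s := by
    rw [← Complex.ofReal_mul, Real.mul_self_sqrt hs.1]
  have hsqrt' : ((√(1 - s) : ℝ) : ℂ) * (√(1 - s) : ℝ) = ((1 - s : ℝ) : ℂ) := by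
    rw [← Complex.ofReal_mul, Real.mul_self_sqrt (sub_nonneg.2 hs.2)]
  rw [← hsqrt', ← hsqrt]
  ext i j
  fin_cases i <;> fin_cases j <;>
    simp [amplitudeDamping, krausMap_apply, amplitudeDampingKraus, Matrix.mul_apply,
      Fin.sum_univ_two, Matrix.single_apply] <;> ring

theorem amplitudeDamping_one : ⇑(amplitudeDamping 1) = id := by
  ext ρ i j
  rw [amplitudeDamping_apply ⟨zero_le_one, le_rfl⟩]
  fin_cases i <;> fin_cases j <;> simp

theorem IsDensityMatrix.amplitudeDamping (hρ : IsDensityMatrix ρ) (hs : s ∈ Set.Icc 0 1) :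
    IsDensityMatrix (amplitudeDamping s ρ) :=
  hρ.krausMap (sum_conjTranspose_mul_amplitudeDampingKraus hs)

theorem complementaryKraus_amplitudeDampingKraus (s : ℝ) (b : Fin 2) :
    complementaryKraus (amplitudeDampingKraus s) b =
      (amplitudeDampingKraus (1 - s) (Equiv.swap 0 1 b)).submatrix (Equiv.swap 0 1) id := by
  ext k i
  fin_cases b <;> fin_cases k <;> fin_cases i <;>
    simp [complementaryKraus, amplitudeDampingKraus]

theorem krausMap_complementaryKraus_amplitudeDampingKraus (s : ℝ)
    (ρ : Matrix (Fin 2) (Fin 2) ℂ) :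
    krausMap (complementaryKraus (amplitudeDampingKraus s)) ρ =
      Matrix.reindex (Equiv.swap 0 1) (Equiv.swap 0 1) (amplitudeDamping (1 - s) ρ) := by
  rw [amplitudeDamping, krausMap_apply, krausMap_apply,
    ← Equiv.sum_comp (Equiv.swap 0 1) fun k => amplitudeDampingKraus (1 - s) k * ρ * _]
  simp only [complementaryKraus_amplitudeDampingKraus]
  ext i j
  simp only [Matrix.sum_apply, Matrix.reindex_apply, Matrix.submatrix_apply, Equiv.symm_swap]
  rfl

theorem qubitPair_amplitudeDamping (hs : s ∈ Set.Icc 0 1) (hρ : IsDensityMatrix ρ) :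
    qubitPair (amplitudeDamping s ρ) = dampPair s (qubitPair ρ) := by
  have h00 : (amplitudeDamping s ρ 0 0).re = s * (ρ 0 0).re := by
    simp [amplitudeDamping_apply hs]
  have h01 : Complex.normSq (amplitudeDamping s ρ 0 1) = s * Complex.normSq (ρ 0 1) := by
    simp [amplitudeDamping_apply hs, Real.mul_self_sqrt hs.1]
  have hdet := re_det_fin_two_of_isHermitian (hρ.amplitudeDamping hs).posSemidef.isHermitian
  rw [(hρ.amplitudeDamping hs).re_apply_one_one, h00, h01] at hdet
  rw [qubitPair, qubitPair, h00, hdet, re_det_fin_two_of_isHermitian hρ.posSemidef.isHermitian,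
    hρ.re_apply_one_one]
  ext <;> simp only [dampPair]
  ring

theorem vonNeumannEntropy_amplitudeDamping (hs : s ∈ Set.Icc 0 1) (hρ : IsDensityMatrix ρ) :
    vonNeumannEntropy (amplitudeDamping s ρ) =
      qubitEntropy (dampPair s (qubitPair ρ)).2 / Real.log 2 := by
  rw [(hρ.amplitudeDamping hs).vonNeumannEntropy_fin_two, qubitPair_amplitudeDamping hs hρ]

theorem vonNeumannEntropy_amplitudeDamping_le (hs : s ∈ Set.Icc 0 1) (hρ : IsDensityMatrix ρ) :
    vonNeumannEntropy (amplitudeDamping s ρ) ≤ Real.binEntropy (s * (ρ 0 0).re) / Real.log 2 := by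
  have hmem := dampPair_mem_qubitRegion hs hρ.qubitPair_mem_qubitRegion
  rw [vonNeumannEntropy_amplitudeDamping hs hρ, ← qubitEntropy_four_mul]
  gcongr
  exact monotoneOn_qubitEntropy (snd_mem_Icc_of_mem_qubitRegion hmem)
    (four_mul_mul_one_sub_mem_Icc hmem.1) hmem.2.2

end AmplitudeDamping

section Symmetric

theorem h2_eq_binEntropy_div (y : ℝ) : h2 y = Real.binEntropy y / Real.log 2 := by
  simp only [h2, Real.logb, Real.binEntropy, Real.log_inv]
  ring

/-- The population of `|0⟩` and four times the determinant of the two states of the symmetric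
ensemble with parameters `p` and `ν`. -/
def symmetricPair (p ν : ℝ) : ℝ × ℝ := (p, 4 * p * (1 - p) * (1 - ν ^ 2))

theorem gFun_eq_qubitEntropy_div (p z ν : ℝ) :
    gFun p z ν = qubitEntropy (dampPair z (symmetricPair p ν)).2 / Real.log 2 := by
  rw [gFun, h2_eq_binEntropy_div, qubitEntropy, dampPair, symmetricPair]
  congr 5
  ring

theorem exists_symmetricPair_eq {q : ℝ × ℝ} (hq : q ∈ qubitRegion) :
    ∃ ν ∈ Set.Icc (0 : ℝ) 1, symmetricPair q.1 ν = q := by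
  obtain ⟨P, y⟩ := q
  obtain ⟨-, hy0, hy1⟩ := hq
  set m := 4 * P * (1 - P) with hm
  have hm0 : 0 ≤ m := hy0.trans hy1
  have hquot : 0 ≤ 1 - y / m := sub_nonneg.2 (div_le_one_of_le₀ hy1 hm0)
  refine ⟨√(1 - y / m), ⟨Real.sqrt_nonneg _, Real.sqrt_le_one.2 ?_⟩, Prod.ext rfl ?_⟩
  · exact sub_le_self _ (div_nonneg hy0 hm0)
  · simp only [symmetricPair]
    rw [← hm, Real.sq_sqrt hquot, sub_sub_cancel]
    exact mul_div_cancel_of_imp' fun h => le_antisymm (hy1.trans_eq h) hy0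

end Symmetric

theorem ratePolyhedron_mono {a b c a' b' c' : ℝ} (ha : a ≤ a') (hb : b ≤ b') (hc : c ≤ c') :
    ratePolyhedron a b c ⊆ ratePolyhedron a' b' c' :=
  fun _ h => ⟨h.1.trans ha, h.2.1.trans hb, h.2.2.trans hc⟩

/-- The polyhedron attained over the amplitude damping channel with transmissivity `η` by the
symmetric ensemble with parameters `p` and `ν`. -/
noncomputable def symmetricPolyhedron (η p ν : ℝ) : Set (ℝ × ℝ × ℝ) :=
  ratePolyhedron (h2 (η * p) + gFun p 1 ν - gFun p (1 - η) ν) (gFun p η ν - gFun p (1 - η) ν)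
    (h2 (η * p) - gFun p (1 - η) ν)

namespace PureEnsemble

open scoped ComplexOrder

variable {X A : Type} [Fintype X] [Fintype A]

theorem isDensityMatrix_meanInput {α : Type} [Fintype α] (e : PureEnsemble X A α) :
    IsDensityMatrix e.meanInput :=
  .sum_smul e.prob_nonneg e.prob_sum e.isDensityMatrix_inputState

theorem exists_inputState_eq {α : Type} [Fintype α] {p : X → ℝ} {ρ : X → Matrix α α ℂ}
    (hp : ∀ x, 0 ≤ p x) (hp1 : ∑ x, p x = 1) (hρ : ∀ x, IsDensityMatrix (ρ x)) :
    ∃ e : PureEnsemble X α α, e.prob = p ∧ e.inputState = ρ := by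
  classical
  open scoped MatrixOrder Matrix.Norms.L2Operator in
  choose B hB using fun x =>
    CStarAlgebra.nonneg_iff_eq_mul_star_self.1 (hρ x).posSemidef.nonneg
  have hnorm (x : X) : ∑ s : α × α, ‖B x s.2 s.1‖ ^ 2 = 1 := by
    have htr := (hρ x).trace_eq_one
    rw [hB x] at htr
    rw [Fintype.sum_prod_type_right, ← Complex.ofReal_inj, Complex.ofReal_one, ← htr]
    push_cast
    exact Finset.sum_congr rfl fun i _ => Finset.sum_congr rfl fun a _ =>
      (Complex.mul_conj' _).symm
  exact ⟨⟨p, hp, hp1, fun x s => B x s.2 s.1, hnorm⟩, rfl, funext fun x => (hB x).symm⟩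

variable {η z : ℝ} (e : PureEnsemble X A (Fin 2))

theorem meanEntropy_amplitudeDamping (hz : z ∈ Set.Icc 0 1) :
    e.meanEntropy (amplitudeDamping z) =
      meanDampedEntropy e.prob (fun x => qubitPair (e.inputState x)) z / Real.log 2 := by
  simp only [meanEntropy, meanDampedEntropy, Finset.sum_div, mul_div_assoc,
    vonNeumannEntropy_amplitudeDamping hz (e.isDensityMatrix_inputState _)]

theorem meanEntropy_complementaryKraus (hη : η ∈ Set.Icc 0 1) :
    e.meanEntropy (krausMap (complementaryKraus (amplitudeDampingKraus η))) =
      e.meanEntropy (amplitudeDamping (1 - η)) := by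
  refine Finset.sum_congr rfl fun x _ => ?_
  rw [krausMap_complementaryKraus_amplitudeDampingKraus, vonNeumannEntropy_reindex]
  exact ((e.isDensityMatrix_inputState x).amplitudeDamping
    (Set.Icc.one_sub_mem hη)).posSemidef.isHermitian

theorem mutualInfoAXB_amplitudeDamping (hη : η ∈ Set.Icc 0 1) :
    mutualInfoAXB (e.cqState (amplitudeDamping η)) =
      vonNeumannEntropy (amplitudeDamping η e.meanInput) + e.meanEntropy (amplitudeDamping 1) -
        e.meanEntropy (amplitudeDamping (1 - η)) := by
  rw [← e.meanEntropy_complementaryKraus hη, amplitudeDamping_one]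
  exact e.mutualInfoAXB_cqState (sum_conjTranspose_mul_amplitudeDampingKraus hη)

theorem coherentInfo_amplitudeDamping (hη : η ∈ Set.Icc 0 1) :
    coherentInfo (e.cqState (amplitudeDamping η)) =
      e.meanEntropy (amplitudeDamping η) - e.meanEntropy (amplitudeDamping (1 - η)) := by
  rw [← e.meanEntropy_complementaryKraus hη]
  exact e.coherentInfo_cqState (sum_conjTranspose_mul_amplitudeDampingKraus hη)

theorem holevoInfo_add_coherentInfo_amplitudeDamping (hη : η ∈ Set.Icc 0 1) :
    holevoInfo (e.cqState (amplitudeDamping η)) + coherentInfo (e.cqState (amplitudeDamping η)) =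
      vonNeumannEntropy (amplitudeDamping η e.meanInput) -
        e.meanEntropy (amplitudeDamping (1 - η)) := by
  have hholevo : holevoInfo (e.cqState (amplitudeDamping η)) =
      vonNeumannEntropy (amplitudeDamping η e.meanInput) - e.meanEntropy (amplitudeDamping η) :=
    e.holevoInfo_cqState (sum_conjTranspose_mul_amplitudeDampingKraus hη)
  rw [hholevo, e.coherentInfo_amplitudeDamping hη, sub_add_sub_cancel]

theorem exists_meanEntropy_amplitudeDamping_le_gFun {t : ℝ} (ht : t ∈ Set.Icc 0 1) :
    ∃ ν ∈ Set.Icc (0 : ℝ) 1,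
      e.meanEntropy (amplitudeDamping t) = gFun (e.meanInput 0 0).re t ν ∧
      ∀ z ∈ Set.Icc t 1, e.meanEntropy (amplitudeDamping z) ≤ gFun (e.meanInput 0 0).re z ν := by
  have hpop : (e.meanInput 0 0).re = ∑ x, e.prob x * (qubitPair (e.inputState x)).1 := by
    simp [meanInput, qubitPair, Matrix.sum_apply]
  obtain ⟨y, hy, heq, hle⟩ := exists_qubitEntropy_dampPair_eq_mean e.prob_nonneg e.prob_sum
    (fun x => (e.isDensityMatrix_inputState x).qubitPair_mem_qubitRegion) ht
  obtain ⟨ν, hν, hpair⟩ := exists_symmetricPair_eq hy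
  refine ⟨ν, hν, ?_, fun z hz => ?_⟩
  · rw [e.meanEntropy_amplitudeDamping ht, gFun_eq_qubitEntropy_div, hpop, hpair, heq]
  · rw [e.meanEntropy_amplitudeDamping ⟨ht.1.trans hz.1, hz.2⟩, gFun_eq_qubitEntropy_div, hpop,
      hpair]
    exact div_le_div_of_nonneg_right (hle z hz) (Real.log_pos one_lt_two).le

theorem exists_polyhedron_subset_symmetricPolyhedron (hη : η ∈ Set.Icc (1 / 2) 1) :
    ∃ p ∈ Set.Icc (0 : ℝ) 1, ∃ ν ∈ Set.Icc (0 : ℝ) 1,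
      e.polyhedron (amplitudeDamping η) ⊆ symmetricPolyhedron η p ν := by
  have hη01 : η ∈ Set.Icc (0 : ℝ) 1 := ⟨by linarith [hη.1], hη.2⟩
  have h1η := Set.Icc.one_sub_mem hη01
  obtain ⟨ν, hν, heq, hle⟩ := e.exists_meanEntropy_amplitudeDamping_le_gFun h1η
  have hone := hle 1 ⟨h1η.2, le_rfl⟩
  have hself := hle η ⟨by linarith [hη.1], hη.2⟩
  have hmean : vonNeumannEntropy (amplitudeDamping η e.meanInput) ≤
      h2 (η * (e.meanInput 0 0).re) := by
    rw [h2_eq_binEntropy_div]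
    exact vonNeumannEntropy_amplitudeDamping_le hη01 e.isDensityMatrix_meanInput
  refine ⟨(e.meanInput 0 0).re, e.isDensityMatrix_meanInput.qubitPair_mem_qubitRegion.1, ν, hν,
    ?_⟩
  rw [polyhedron, e.mutualInfoAXB_amplitudeDamping hη01,
    e.holevoInfo_add_coherentInfo_amplitudeDamping hη01, e.coherentInfo_amplitudeDamping hη01, heq]
  exact ratePolyhedron_mono (by gcongr) (by gcongr) (by gcongr)

namespace IsSymmetric

variable {e : PureEnsemble (Fin 2) A (Fin 2)} {p ν : ℝ}

theorem qubitPair_inputState (he : e.IsSymmetric p ν) (hp : p ∈ Set.Icc 0 1) (x : Fin 2) :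
    qubitPair (e.inputState x) = symmetricPair p ν := by
  have hsq : (ν * √(p * (1 - p))) ^ 2 = ν ^ 2 * (p * (1 - p)) := by
    rw [mul_pow, Real.sq_sqrt (mul_nonneg hp.1 (sub_nonneg.2 hp.2))]
  have hx : qubitPair (e.inputState x) = (p, 4 * (p * (1 - p) - ν ^ 2 * (p * (1 - p)))) := by
    fin_cases x
    · simp only [Fin.zero_eta, he.2.1, qubitPair_qubitState, hsq]
    · simp only [Fin.mk_one, he.2.2, qubitPair_qubitState, neg_sq, hsq]
  rw [hx, symmetricPair]
  congr 1
  ring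

theorem meanInput_eq (he : e.IsSymmetric p ν) : e.meanInput = qubitState p 0 := by
  rw [meanInput, Fin.sum_univ_two, he.1, he.1, he.2.1, he.2.2]
  ext i j
  fin_cases i <;> fin_cases j <;> simp [qubitState] <;> ring

theorem meanEntropy_eq_gFun (he : e.IsSymmetric p ν) (hp : p ∈ Set.Icc 0 1)
    (hz : z ∈ Set.Icc 0 1) : e.meanEntropy (amplitudeDamping z) = gFun p z ν := by
  rw [e.meanEntropy_amplitudeDamping hz, gFun_eq_qubitEntropy_div]
  simp only [meanDampedEntropy, he.qubitPair_inputState hp, ← Finset.sum_mul, e.prob_sum, one_mul]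

theorem vonNeumannEntropy_meanInput (he : e.IsSymmetric p ν) (hη : η ∈ Set.Icc 0 1) :
    vonNeumannEntropy (amplitudeDamping η e.meanInput) = h2 (η * p) := by
  have hpair : qubitPair e.meanInput = (p, 4 * p * (1 - p)) := by
    rw [he.meanInput_eq, qubitPair_qubitState, zero_pow two_ne_zero, sub_zero, mul_assoc]
  rw [vonNeumannEntropy_amplitudeDamping hη e.isDensityMatrix_meanInput, hpair,
    qubitEntropy_dampPair_diagonal, h2_eq_binEntropy_div]

theorem informations_eq (he : e.IsSymmetric p ν) (hp : p ∈ Set.Icc 0 1) (hη : η ∈ Set.Icc 0 1) :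
    mutualInfoAXB (e.cqState (amplitudeDamping η)) =
        h2 (η * p) + gFun p 1 ν - gFun p (1 - η) ν ∧
      coherentInfo (e.cqState (amplitudeDamping η)) = gFun p η ν - gFun p (1 - η) ν ∧
      holevoInfo (e.cqState (amplitudeDamping η)) + coherentInfo (e.cqState (amplitudeDamping η)) =
        h2 (η * p) - gFun p (1 - η) ν := by
  rw [e.holevoInfo_add_coherentInfo_amplitudeDamping hη, e.mutualInfoAXB_amplitudeDamping hη,
    e.coherentInfo_amplitudeDamping hη, he.vonNeumannEntropy_meanInput hη,
    he.meanEntropy_eq_gFun hp ⟨zero_le_one, le_rfl⟩, he.meanEntropy_eq_gFun hp hη,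
    he.meanEntropy_eq_gFun hp (Set.Icc.one_sub_mem hη)]
  exact ⟨rfl, rfl, rfl⟩

theorem polyhedron_eq (he : e.IsSymmetric p ν) (hp : p ∈ Set.Icc 0 1) (hη : η ∈ Set.Icc 0 1) :
    e.polyhedron (amplitudeDamping η) = symmetricPolyhedron η p ν := by
  obtain ⟨hmutual, hcoherent, hsum⟩ := he.informations_eq hp hη
  rw [polyhedron, hsum, hmutual, hcoherent, symmetricPolyhedron]

end IsSymmetric

theorem exists_isSymmetric {p ν : ℝ} (hp : p ∈ Set.Icc 0 1) (hν : ν ∈ Set.Icc 0 1) :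
    ∃ e : PureEnsemble (Fin 2) (Fin 2) (Fin 2), e.IsSymmetric p ν := by
  have hc : (ν * √(p * (1 - p))) ^ 2 ≤ p * (1 - p) := by
    have hvar := mul_nonneg hp.1 (sub_nonneg.2 hp.2)
    rw [mul_pow, Real.sq_sqrt hvar]
    exact mul_le_of_le_one_left hvar (pow_le_one₀ hν.1 hν.2)
  obtain ⟨e, hprob, hinput⟩ := exists_inputState_eq (p := fun _ : Fin 2 => (1 / 2 : ℝ))
    (ρ := ![qubitState p (ν * √(p * (1 - p))), qubitState p (-(ν * √(p * (1 - p))))])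
    (fun _ => by positivity) (by simp)
    (Fin.forall_fin_two.2 ⟨isDensityMatrix_qubitState hc,
      isDensityMatrix_qubitState ((neg_sq _).trans_le hc)⟩)
  exact ⟨e, congrFun hprob, congrFun hinput 0, congrFun hinput 1⟩

end PureEnsemble

section Region

variable {η : ℝ}

theorem tripleTradeoffRegion_amplitudeDamping (hη : η ∈ Set.Icc (1 / 2) 1) :
    tripleTradeoffRegion (amplitudeDamping η) =
      ⋃ p ∈ Set.Icc (0 : ℝ) 1, ⋃ ν ∈ Set.Icc (0 : ℝ) 1, symmetricPolyhedron η p ν := by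
  refine Set.Subset.antisymm (Set.iUnion_subset fun n => Set.iUnion₂_subset fun d e => ?_)
    (Set.iUnion₂_subset fun p hp => Set.iUnion₂_subset fun ν hν => ?_)
  · obtain ⟨p, hp, ν, hν, hsub⟩ := e.exists_polyhedron_subset_symmetricPolyhedron hη
    exact Set.subset_iUnion₂_of_subset p hp (Set.subset_iUnion₂_of_subset ν hν hsub)
  · obtain ⟨e, he⟩ := PureEnsemble.exists_isSymmetric hp hν
    rw [← he.polyhedron_eq hp ⟨by linarith [hη.1], hη.2⟩]
    exact Set.subset_iUnion_of_subset 2 (Set.subset_iUnion₂_of_subset 2 e subset_rfl)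

theorem iUnion_polyhedron_isSymmetric {p ν : ℝ} (hp : p ∈ Set.Icc 0 1) (hν : ν ∈ Set.Icc 0 1)
    (hη : η ∈ Set.Icc 0 1) :
    (⋃ (d : ℕ) (e : PureEnsemble (Fin 2) (Fin d) (Fin 2)) (_ : e.IsSymmetric p ν),
      e.polyhedron (amplitudeDamping η)) = symmetricPolyhedron η p ν := by
  refine Set.Subset.antisymm (Set.iUnion_subset fun d => Set.iUnion₂_subset fun e he =>
    (he.polyhedron_eq hp hη).subset) ?_
  obtain ⟨e, he⟩ := PureEnsemble.exists_isSymmetric hp hν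
  exact Set.subset_iUnion_of_subset 2
    (Set.subset_iUnion₂_of_subset e he (he.polyhedron_eq hp hη).superset)

end Region

theorem mainTheorem5 (η : ℝ) (hη : 1 / 2 ≤ η) (hη1 : η ≤ 1) :
    tripleTradeoffRegion (amplitudeDamping η) =
        (⋃ p ∈ Set.Icc (0 : ℝ) 1, ⋃ ν ∈ Set.Icc (0 : ℝ) 1,
          ratePolyhedron
            (h2 (η * p) + gFun p 1 ν - gFun p (1 - η) ν)
            (gFun p η ν - gFun p (1 - η) ν)
            (h2 (η * p) - gFun p (1 - η) ν)) ∧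
      (∀ p ∈ Set.Icc (0 : ℝ) 1, ∀ ν ∈ Set.Icc (0 : ℝ) 1,
        (∃ (d : ℕ) (e : PureEnsemble (Fin 2) (Fin d) (Fin 2)), e.IsSymmetric p ν) ∧
        ∀ (d : ℕ) (e : PureEnsemble (Fin 2) (Fin d) (Fin 2)), e.IsSymmetric p ν →
          mutualInfoAXB (e.cqState (amplitudeDamping η)) =
              h2 (η * p) + gFun p 1 ν - gFun p (1 - η) ν ∧
          coherentInfo (e.cqState (amplitudeDamping η)) =
              gFun p η ν - gFun p (1 - η) ν ∧
          holevoInfo (e.cqState (amplitudeDamping η)) +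
                coherentInfo (e.cqState (amplitudeDamping η)) =
              h2 (η * p) - gFun p (1 - η) ν) ∧
      tripleTradeoffRegion (amplitudeDamping η) =
        (⋃ p ∈ Set.Icc (0 : ℝ) 1, ⋃ ν ∈ Set.Icc (0 : ℝ) 1,
          ⋃ (d : ℕ) (e : PureEnsemble (Fin 2) (Fin d) (Fin 2)) (_ : e.IsSymmetric p ν),
            e.polyhedron (amplitudeDamping η)) := by
  have hη01 : η ∈ Set.Icc (0 : ℝ) 1 := ⟨by linarith, hη1⟩
  have hregion := tripleTradeoffRegion_amplitudeDamping ⟨hη, hη1⟩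
  refine ⟨hregion, fun p hp ν hν => ⟨⟨2, PureEnsemble.exists_isSymmetric hp hν⟩,
    fun d e he => he.informations_eq hp hη01⟩, ?_⟩
  rw [hregion]
  exact Set.iUnion₂_congr fun p hp => Set.iUnion₂_congr fun ν hν =>
    (iUnion_polyhedron_isSymmetric hp hν hη01).symm
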